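/- Let $Z$ be a positive random variable with continuous distribution function $G$. Assume that for some $\hat x>0$ the function $G$ is of class $C^2$ and strictly increasing on $[0,\hat x]$, and that $G'(0+)>0$. Let $(s_n)$ be a sequence of positive numbers with $s_n\log n\to\infty$ and $s_n^2\log n\to0$ as $n\to\infty$. For each $n$, give the edges $e$ of the complete graph $K_n$ on $\{1,\dots,n\}$ independent weights $X_e$, each distributed as $Z^{s_n}$. For $n\ge2$ let $H_n$ be the number of edges of the (almost surely unique) self-avoiding path $p$ between the vertices $1$ and $2$ that minimizes the weight $\sum_{e\in p}X_e$. Let $(\beta_n)$ be a sequence in $(0,\infty)$ such that $$\limsup_{n\to\infty}\frac{s_n\log(1/s_n)}{\beta_n^2}\le\frac12-\delta\ \text{ for some }\delta>0,\qquad \lim_{n\to\infty}\frac{s_n\log n-\lfloor s_n\log n\rfloor}{\beta_n s_n\log n}=0.$$ Then $$\mathbb P\Big(\frac{1}{1+\beta_n}\,s_n\log n<H_n<\frac{1}{1-\beta_n}\,s_n\log n\Big)\to1\qquad\text{as }n\to\infty,$$ where the upper bound $\frac{1}{1-\beta_n}s_n\log n$ is read as $+\infty$ for those $n$ with $\beta_n\ge1$.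 -/

import Mathlib

open Filter Topology MeasureTheory ProbabilityTheory

noncomputable section

namespace FirstPassage

/-- The weight `∑_{e ∈ p} w e` of a self-avoiding path `p`, for edge weights `w`. -/
def pathWeight {V : Type*} {G : SimpleGraph V} {u v : V} (w : Sym2 V → ℝ) (p : G.Path u v) : ℝ :=
  (p.1.edges.map w).sum

/-- `p` has minimal weight among all self-avoiding paths of `G` with the same two end points. -/
def IsOptimalPath {V : Type*} {G : SimpleGraph V} {u v : V} (w : Sym2 V → ℝ) (p : G.Path u v) :
    Prop :=
  ∀ q : G.Path u v, pathWeight w p ≤ pathWeight w q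

/-- The number of edges of the optimal path from `u` to `v`. If several paths are optimal (an event
of probability zero for independent edge weights with continuous distribution functions), the
smallest number of edges is taken. -/
def hopcountBetween {V : Type*} (G : SimpleGraph V) (w : Sym2 V → ℝ) (u v : V) : ℕ :=
  sInf {k : ℕ | ∃ p : G.Path u v, IsOptimalPath w p ∧ p.1.length = k}

/-- The hopcount on the complete graph with `n` vertices, between its first two vertices (which are
`0` and `1` in `Fin n`). It is meaningful for `2 ≤ n` only, and set to `0` otherwise. Only the
values of `w` at the edges matter, not those at the diagonal elements of `Sym2 (Fin n)`. -/
def hopcount (n : ℕ) (w : Sym2 (Fin n) → ℝ) : ℕ :=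
  if hn : 2 ≤ n then
    hopcountBetween (⊤ : SimpleGraph (Fin n)) w ⟨0, by omega⟩ ⟨1, by omega⟩
  else 0

end FirstPassage

end

/-! Write `L = s log n` and `κ = ⌊L⌋`. There are at most `n ^ (j - 1)` paths with `j` edges, and an
edge has weight at most `y` with probability of order `y ^ (1 / s)` near `0`. So the lightest path
with `j` edges weighs roughly `n ^ (-s) * exp (φ j)`, where `φ j = L / j + log j`. This exponent is
minimal at `j = L`, and `φ j - φ L = y - 1 - log y` for `y = L / j`, which is quadratic at `y = 1`.

Upper bound for the optimal weight: call an edge open if its weight is at most a threshold `τ`,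
chosen so that this has probability at least `p`, of order `n ^ (1 / κ - 1)`. Exploring in layers
that grow by a factor `a`, about `2 * n ^ (1 / κ)`, yields an open walk with `κ` edges
(`measureReal_not_reach_le`), hence a path of weight at most `κ τ`. Since `s L → 0`, `n ^ (1 / κ)`
beats every fixed power of `exp L`, which absorbs all losses.

Exclusion of atypical lengths: a union bound over paths with the Chernoff estimate
`measureReal_sum_le_le` bounds the chance of a path with `j` edges and weight at most `κ τ` by the
`j`-th power of a multiple of `exp (-Δ)`, where `Δ = (φ j - φ κ) / s - log (1 / s)`. For atypical
`j`, `φ j - φ L` is at least about `β ^ 2 / 2` (for small `β`). The limsup hypothesis lets this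
outweigh `s log (1 / s)`, the floor hypothesis makes `φ κ - φ L` negligible, and `Δ ≥ (δ / 2) log (1
/ s) → ∞` (`mul_log_inv_le_exponent`). -/

namespace FirstPassage

/-! ### Independence and tail bounds for product measures -/

section ProductMeasure

variable {ι : Type*} [Fintype ι] (ρ : ι → Measure Prop) [∀ i, IsProbabilityMeasure (ρ i)]

/-- Functions of disjoint sets of coordinates are independent under a product measure. -/
lemma indepFun_pi_of_dependsOn {α β : Type*} [MeasurableSpace α] [MeasurableSpace β]
    {F : (ι → Prop) → α} {H : (ι → Prop) → β} {A B : Set ι} (hAB : Disjoint A B)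
    (hF : DependsOn F A) (hH : DependsOn H B) : IndepFun F H (Measure.pi ρ) := by
  classical
  have hind : iIndepFun (fun i (o : ι → Prop) => o i) (Measure.pi ρ) :=
    iIndepFun_pi (X := fun _ x => x) (fun i => aemeasurable_id)
  have h := hind.indepFun_finset A.toFinset B.toFinset (by simpa using hAB)
    (fun i => measurable_pi_apply i)
  -- Coordinates outside `C` are filled with `False`; by `DependsOn` the filling does not affect the
  -- value.
  let ext (C : Set ι) (r : C.toFinset → Prop) : ι → Prop :=
    fun i => if h : i ∈ C.toFinset then r ⟨i, h⟩ else False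
  have h2 := h.comp (φ := fun r => F (ext A r)) (ψ := fun r => H (ext B r))
    Measurable.of_discrete Measurable.of_discrete
  have e1 : ((fun r => F (ext A r)) ∘ fun (o : ι → Prop) (i : A.toFinset) => o i) = F := by
    funext o
    refine hF fun i hi => ?_
    simp [ext, hi]
  have e2 : ((fun r => H (ext B r)) ∘ fun (o : ι → Prop) (i : B.toFinset) => o i) = H := by
    funext o
    refine hH fun i hi => ?_
    simp [ext, hi]
  rwa [e1, e2] at h2

lemma measureReal_pi_and_of_dependsOn {F H : (ι → Prop) → Prop} {A B : Set ι}
    (hAB : Disjoint A B) (hF : DependsOn F A) (hH : DependsOn H B) :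
    (Measure.pi ρ).real {o | F o ∧ H o} =
      (Measure.pi ρ).real {o | F o} * (Measure.pi ρ).real {o | H o} := by
  have h := (indepFun_pi_of_dependsOn ρ hAB hF hH).measure_inter_preimage_eq_mul {True} {True}
    .of_discrete .of_discrete
  have e (F : (ι → Prop) → Prop) : F ⁻¹' {True} = {o | F o} := by ext o; simp
  rw [e, e] at h
  rw [measureReal_def, measureReal_def, measureReal_def, ← ENNReal.toReal_mul, ← h]
  rfl

/-- The probability that no coordinate in a finite set holds. -/
lemma measureReal_pi_forall_not_le {p : ℝ} (hp : ∀ i, p ≤ (ρ i).real {True})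
    (A : Finset ι) : (Measure.pi ρ).real {o | ∀ i ∈ A, ¬ o i} ≤ Real.exp (-(A.card * p)) := by
  classical
  have e : {o : ι → Prop | ∀ i ∈ A, ¬ o i} =
      Set.pi Set.univ (fun i => if i ∈ A then ({False} : Set Prop) else Set.univ) := by
    ext o
    simp only [Set.mem_ofPred_eq, Set.mem_pi, Set.mem_univ, true_implies]
    refine forall_congr' fun i => ?_
    by_cases hi : i ∈ A <;> simp [hi]
  rw [e, measureReal_def, Measure.pi_pi, ENNReal.toReal_prod]
  have h1 : ∀ i, (ρ i (if i ∈ A then ({False} : Set Prop) else Set.univ)).toReal ≤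
      if i ∈ A then Real.exp (-p) else 1 := by
    intro i
    by_cases hi : i ∈ A
    · simp only [hi, if_true]
      have hc : ({False} : Set Prop) = {True}ᶜ := by ext x; simp
      have h2 := probReal_compl_eq_one_sub (μ := ρ i) (s := {True}) .of_discrete
      rw [← hc, measureReal_def] at h2
      rw [h2]
      have := Real.add_one_le_exp (-p)
      linarith [hp i]
    · simp [hi]
  calc _ ≤ ∏ i, (if i ∈ A then Real.exp (-p) else 1) :=
        Finset.prod_le_prod (fun i _ => ENNReal.toReal_nonneg) (fun i _ => h1 i)
    _ = Real.exp (-(A.card * p)) := by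
        rw [Finset.prod_ite_mem, Finset.univ_inter, Finset.prod_const, ← Real.exp_nat_mul]
        ring_nf

/-- Lower tail of the number of successes among events depending on disjoint coordinates. -/
lemma measureReal_card_filter_lt_le {τ : Type*} (U : Finset τ)
    (I : τ → (ι → Prop) → Prop) [∀ o, DecidablePred fun t => I t o] (B : τ → Set ι)
    (hB : (U : Set τ).PairwiseDisjoint B) (hI : ∀ t ∈ U, DependsOn (I t) (B t))
    {q : ℝ} (hq : ∀ t ∈ U, q ≤ (Measure.pi ρ).real {o | I t o}) {r : ℕ} (hr : 0 < r)
    (hqr : 2 * r ≤ U.card * q) :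
    (Measure.pi ρ).real {o | (U.filter fun t => I t o).card < r} ≤ 2 / r := by
  classical
  set μ := Measure.pi ρ
  let Y : τ → (ι → Prop) → ℝ := fun t o => if I t o then 1 else 0
  have hYm (t) : MemLp (Y t) 2 μ := by
    refine MemLp.of_bound Measurable.of_discrete.aestronglyMeasurable 1 (ae_of_all _ fun o => ?_)
    simp only [Y]; split_ifs <;> simp
  have hEY (t) : ∫ o, Y t o ∂μ = μ.real {o | I t o} := by
    have : Y t = Set.indicator {o | I t o} 1 := by
      ext o; simp [Y, Set.indicator_apply]
    rw [this, integral_indicator_one .of_discrete]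
  have hvar (t) : Var[Y t; μ] ≤ μ.real {o | I t o} := by
    refine (variance_le_expectation_sq (hYm t).aestronglyMeasurable).trans (le_of_eq ?_)
    rw [← hEY t]
    congr 1
    ext o
    simp [Y]
  have hind : (U : Set τ).Pairwise fun i j => Y i ⟂ᵢ[μ] Y j := by
    intro i hi j hj hij
    refine indepFun_pi_of_dependsOn ρ (hB hi hj hij) ?_ ?_
    · intro x y hxy
      simp only [Y, hI i hi hxy]
    · intro x y hxy
      simp only [Y, hI j hj hxy]
  set N : (ι → Prop) → ℝ := ∑ t ∈ U, Y t with hN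
  set E : ℝ := ∑ t ∈ U, μ.real {o | I t o} with hE
  have hEN : ∫ o, N o ∂μ = E := by
    simp only [hN, Finset.sum_apply]
    rw [integral_finsetSum _ (fun t _ => (hYm t).integrable (by norm_num))]
    exact Finset.sum_congr rfl fun t _ => hEY t
  have hVN : Var[N; μ] ≤ E := by
    rw [hN, IndepFun.variance_sum (fun t _ => hYm t) hind]
    exact Finset.sum_le_sum fun t _ => hvar t
  have hEr : 2 * (r : ℝ) ≤ E := by
    refine hqr.trans ?_
    rw [← nsmul_eq_mul]
    exact Finset.card_nsmul_le_sum _ _ _ hq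
  have hr' : (0 : ℝ) < r := by exact_mod_cast hr
  have hE0 : 0 < E := by linarith
  -- Chebyshev at distance `E / 2`: since `r ≤ E / 2`, a count below `r` deviates by at least `E /
  -- 2` from its mean `E`.
  have hch := meas_ge_le_variance_div_sq (memLp_finsetSum' U fun t _ => hYm t)
    (c := E / 2) (by positivity) (μ := μ)
  rw [← hN] at hch
  have hsub : {o | (U.filter fun t => I t o).card < r} ⊆ {o | E / 2 ≤ |N o - ∫ x, N x ∂μ|} := by
    intro o ho
    have hNo : N o = (U.filter fun t => I t o).card := by
      simp [hN, Y, Finset.sum_apply]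
    have ho' : ((U.filter fun t => I t o).card : ℝ) < r := by exact_mod_cast ho
    simp only [Set.mem_ofPred_eq]
    rw [hEN, hNo, abs_sub_comm]
    refine le_trans ?_ (le_abs_self _)
    linarith
  refine (measureReal_mono hsub).trans ?_
  refine (ENNReal.toReal_le_of_le_ofReal (by have := variance_nonneg N μ; positivity) hch).trans ?_
  calc Var[N; μ] / (E / 2) ^ 2 ≤ E / (E / 2) ^ 2 := by gcongr
    _ = 4 / E := by field_simp; norm_num
    _ ≤ 4 / (2 * r) := by gcongr
    _ = 2 / r := by field_simp; norm_num

end ProductMeasure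

/-! ### Layered exploration of the open subgraph -/

section Exploration

variable {V : Type*}

/-- The two vertices are distinct and joined by an open edge of the complete graph. -/
def OpenAdj (o : (⊤ : SimpleGraph V).edgeSet → Prop) (a b : V) : Prop :=
  ∃ h : a ≠ b, o ⟨s(a, b), by simpa using h⟩

/-- The edges of the complete graph between two sets of vertices. -/
def edgesBetween (S T : Finset V) : Set (⊤ : SimpleGraph V).edgeSet :=
  {e | ∃ a ∈ S, ∃ b ∈ T, e.1 = s(a, b)}

lemma edgesBetween_mono {S S' T T' : Finset V} (hS : S ⊆ S') (hT : T ⊆ T') :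
    edgesBetween S T ⊆ edgesBetween S' T' := by
  rintro e ⟨a, ha, b, hb, he⟩
  exact ⟨a, hS ha, b, hT hb, he⟩

lemma dependsOn_openAdj {S T : Finset V} {a b : V} (ha : a ∈ S) (hb : b ∈ T) :
    DependsOn (fun o => OpenAdj o a b) (edgesBetween S T) := by
  intro x y hxy
  simp only [OpenAdj, eq_iff_iff]
  refine exists_congr fun h => ?_
  rw [hxy _ ⟨a, ha, b, hb, rfl⟩]

lemma dependsOn_exists_openAdj (S : Finset V) {T : Finset V} {t : V} (ht : t ∈ T) :
    DependsOn (fun o => ∃ a ∈ S, OpenAdj o a t) (edgesBetween S T) := by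
  intro x y hxy
  simp only [eq_iff_iff]
  exact exists_congr fun a => and_congr_right fun ha => iff_of_eq (dependsOn_openAdj ha ht hxy)

variable [DecidableEq V]

/-- Starting from some vertex of `S`, one can get to `v` by `j + 1` open edges, with the `j`
intermediate vertices in `U`, found by exploring `U` layer by layer. -/
def Reach (o : (⊤ : SimpleGraph V).edgeSet → Prop) (v : V) : ℕ → Finset V → Finset V → Prop
  | 0, S, _ => ∃ a ∈ S, OpenAdj o a v
  | j + 1, S, U => ∃ T ⊆ U, (∀ t ∈ T, ∃ a ∈ S, OpenAdj o a t) ∧ Reach o v j T (U \ T)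

/-- Every edge inspected by the exploration joins `S ∪ U` to `U` or `v`. The precise edge set
matters for the independence of successive layers. -/
lemma dependsOn_reach (v : V) (j : ℕ) (S U : Finset V) :
    DependsOn (fun o => Reach o v j S U) (edgesBetween (S ∪ U) (insert v U)) := by
  induction j generalizing S U with
  | zero =>
    intro x y hxy
    simp only [Reach]
    exact dependsOn_exists_openAdj S (T := insert v U) (by simp) fun i hi =>
      hxy i (edgesBetween_mono Finset.subset_union_left subset_rfl hi)
  | succ j ih =>
    intro x y hxy
    simp only [Reach, eq_iff_iff]
    refine exists_congr fun T => and_congr_right fun hT => ?_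
    refine and_congr (forall₂_congr fun t ht => ?_) ?_
    · exact iff_of_eq (dependsOn_exists_openAdj S (T := insert v U)
        (Finset.mem_insert_of_mem (hT ht)) fun i hi =>
          hxy i (edgesBetween_mono Finset.subset_union_left subset_rfl hi))
    · refine iff_of_eq (ih T (U \ T) fun i hi => hxy i (edgesBetween_mono ?_ ?_ hi))
      · exact (Finset.union_subset hT Finset.sdiff_subset).trans Finset.subset_union_right
      · exact Finset.insert_subset_insert v Finset.sdiff_subset

/-- Edges of the present layer touch `S`, whereas later ones have both ends in `U ∪ {v}`, which
misses `S`. Hence the rest of the exploration is independent of the present layer. -/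
lemma disjoint_edgesBetween {S U : Finset V} {v : V} {T W : Finset V} (hSU : Disjoint S U)
    (hv : v ∉ S) (hT : T ⊆ U) (hW : W ⊆ U) :
    Disjoint (edgesBetween S U) (edgesBetween T (insert v W)) := by
  rw [Set.disjoint_left]
  rintro e ⟨a, ha, b, hb, he⟩ ⟨c, hc, d, hd, he'⟩
  rw [he, Sym2.eq_iff] at he'
  rcases he' with ⟨rfl, -⟩ | ⟨rfl, -⟩
  · exact Finset.disjoint_left.1 hSU ha (hT hc)
  · rcases Finset.mem_insert.1 hd with rfl | hd
    · exact hv ha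
    · exact Finset.disjoint_left.1 hSU ha (hW hd)

/-- A successful exploration yields an open walk. -/
lemma Reach.exists_walk {o : (⊤ : SimpleGraph V).edgeSet → Prop} {v : V} {j : ℕ}
    {S U : Finset V} (h : Reach o v j S U) :
    ∃ a ∈ S, ∃ p : (⊤ : SimpleGraph V).Walk a v, p.length = j + 1 ∧
      ∀ e ∈ p.edges, ∃ he : e ∈ (⊤ : SimpleGraph V).edgeSet, o ⟨e, he⟩ := by
  induction j generalizing S U with
  | zero =>
    obtain ⟨a, ha, hav, ho⟩ := h
    refine ⟨a, ha, SimpleGraph.Walk.cons (by simpa using hav) SimpleGraph.Walk.nil, by simp, ?_⟩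
    intro e he
    simp only [SimpleGraph.Walk.edges_cons, SimpleGraph.Walk.edges_nil, List.mem_singleton] at he
    subst he
    exact ⟨_, ho⟩
  | succ j ih =>
    obtain ⟨T, -, hST, hT⟩ := h
    obtain ⟨t, ht, p, hp, hpo⟩ := ih hT
    obtain ⟨a, ha, hat, ho⟩ := hST t ht
    refine ⟨a, ha, SimpleGraph.Walk.cons (by simpa using hat) p, by simp [hp], ?_⟩
    intro e he
    rcases List.mem_cons.1 (by simpa using he) with rfl | he
    · exact ⟨_, ho⟩
    · exact hpo e he

variable [Fintype V] (ρ : (⊤ : SimpleGraph V).edgeSet → Measure Prop)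
  [∀ i, IsProbabilityMeasure (ρ i)]

/-- The edges from `t` to the points of `S` are `S.card` distinct coordinates. -/
lemma measureReal_not_exists_openAdj_le {p : ℝ} (hp : ∀ i, p ≤ (ρ i).real {True})
    {S : Finset V} {t : V} (ht : t ∉ S) :
    (Measure.pi ρ).real {o | ¬ ∃ a ∈ S, OpenAdj o a t} ≤ Real.exp (-(S.card * p)) := by
  have hne (a : S) : a.1 ≠ t := fun h => ht (h ▸ a.2)
  let f : S ↪ (⊤ : SimpleGraph V).edgeSet :=
    ⟨fun a => ⟨s(a.1, t), by simpa using hne a⟩, by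
      intro a b hab
      have h : s(a.1, t) = s(b.1, t) := congrArg Subtype.val hab
      exact Subtype.ext (Sym2.congr_left.1 h)⟩
  have h := measureReal_pi_forall_not_le ρ hp (S.attach.map f)
  rw [Finset.card_map, Finset.card_attach] at h
  refine (measureReal_mono fun o ho => ?_).trans h
  simp only [Set.mem_ofPred_eq, Finset.mem_map, forall_exists_index, and_imp] at ho ⊢
  rintro e a - rfl hoe
  exact ho ⟨a, a.2, hne a, hoe⟩

/-- One step of the exploration: the set reached from `S` inside `U` is large. -/
lemma measureReal_card_neighbors_lt_le {p : ℝ} (hp0 : 0 ≤ p)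
    (hp : ∀ i, p ≤ (ρ i).real {True}) {S U : Finset V}
    (hSU : Disjoint S U) {r : ℕ} (hr : 0 < r) (hS : S.card * p ≤ 1)
    (hU : 4 * r ≤ U.card * (S.card * p))
    [∀ o : (⊤ : SimpleGraph V).edgeSet → Prop, DecidablePred fun t => ∃ a ∈ S, OpenAdj o a t] :
    (Measure.pi ρ).real {o | (U.filter fun t => ∃ a ∈ S, OpenAdj o a t).card < r} ≤ 2 / r := by
  refine measureReal_card_filter_lt_le ρ U (fun t o => ∃ a ∈ S, OpenAdj o a t)
    (fun t => edgesBetween S {t}) ?_ (fun t _ => dependsOn_exists_openAdj S (by simp))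
    (q := S.card * p / 2) ?_ hr (by linarith)
  · intro t ht t' ht' htt'
    rw [Function.onFun, Set.disjoint_left]
    rintro e ⟨a, ha, b, hb, he⟩ ⟨c, hc, d, hd, he'⟩
    rw [Finset.mem_singleton] at hb hd
    subst hb hd
    rw [he, Sym2.eq_iff] at he'
    rcases he' with ⟨-, h⟩ | ⟨rfl, h⟩
    · exact htt' h
    · exact Finset.disjoint_left.1 hSU ha ht'
  · intro t ht
    have h1 := measureReal_not_exists_openAdj_le ρ hp
      (fun h => Finset.disjoint_left.1 hSU h ht : t ∉ S)
    have hc : {o : (⊤ : SimpleGraph V).edgeSet → Prop | ¬ ∃ a ∈ S, OpenAdj o a t} =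
      {o | ∃ a ∈ S, OpenAdj o a t}ᶜ := rfl
    rw [hc, probReal_compl_eq_one_sub .of_discrete] at h1
    set x : ℝ := S.card * p with hx
    have hx0 : 0 ≤ x := by positivity
    -- Valid for `0 ≤ x ≤ 1`, because `exp x ≥ 1 + x` and `(1 + x) * (1 - x / 2) ≥ 1`.
    have h2 : Real.exp (-x) ≤ 1 - x / 2 := by
      rw [Real.exp_neg]
      have h3 := Real.add_one_le_exp x
      rw [inv_le_comm₀ (Real.exp_pos x) (by linarith)]
      refine le_trans ?_ h3
      rw [inv_le_iff_one_le_mul₀ (by linarith)]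
      nlinarith
    linarith

/-- The exploration succeeds with high probability. -/
theorem measureReal_not_reach_le {p : ℝ} (hp : ∀ i, p ≤ (ρ i).real {True}) {a u M : ℕ}
    (ha : 1 ≤ a) (hu : 0 < u) (hup : u * p = 4 * a) (hM : 4 * M ≤ u) (v : V) (j i : ℕ)
    (S U : Finset V) (hSU : Disjoint S U) (hvS : v ∉ S) (hvU : v ∉ U) (hij : a ^ (i + j) ≤ M)
    (hS : S.card = a ^ i) (hU : u + j * M ≤ U.card) :
    (Measure.pi ρ).real {o | ¬ Reach o v j S U} ≤
      j * (2 / a) + Real.exp (-((a : ℝ) ^ (i + j) * p)) := by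
  classical
  set μ := Measure.pi ρ
  have hu' : (0 : ℝ) < u := by exact_mod_cast hu
  have hp0 : 0 ≤ p := by
    by_contra! hneg
    have h1 : u * p < 0 := mul_neg_of_pos_of_neg hu' hneg
    have h2 : (0 : ℝ) ≤ 4 * a := by positivity
    linarith
  induction j generalizing i S U with
  | zero =>
    have h := measureReal_not_exists_openAdj_le ρ hp hvS
    simpa [Reach, hS] using h
  | succ j ih =>
    set r := a ^ (i + 1) with hr
    have hr0 : 0 < r := by positivity
    have hrM : r ≤ M := (Nat.pow_le_pow_right ha (by omega)).trans hij
    have hSr : (S.card : ℝ) * a = r := by rw [hS, hr]; push_cast; ring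
    -- From `u * p = 4 * a` follows `u * (S.card * p) = 4 * r`. Then `4 * r ≤ 4 * M ≤ u` gives
    -- `S.card * p ≤ 1`, and `u ≤ U.card` gives the condition on the mean.
    have hN := measureReal_card_neighbors_lt_le ρ hp0 hp hSU hr0 (U := U) (by
        have h1 : (r : ℝ) ≤ M := by exact_mod_cast hrM
        have h2 : (4 : ℝ) * M ≤ u := by exact_mod_cast hM
        have h3 : u * (S.card * p) = 4 * r := by rw [← hSr]; linear_combination (S.card : ℝ) * hup
        by_contra! hlt
        nlinarith) (by
        have h1 : (u : ℝ) ≤ U.card := by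
          exact_mod_cast le_trans (Nat.le_add_right _ _) hU
        calc (4 : ℝ) * r = u * (S.card * p) := by
              rw [← hSr]; linear_combination -(S.card : ℝ) * hup
          _ ≤ U.card * (S.card * p) := by gcongr)
    let N (o : (⊤ : SimpleGraph V).edgeSet → Prop) : Finset V :=
      U.filter fun t => ∃ a ∈ S, OpenAdj o a t
    -- The next layer is trimmed to exactly `r` vertices by a rule `c` depending only on the
    -- neighbour set found, so that fixing this set fixes the next layer.
    have hc : ∀ T : Finset V, ∃ T' : Finset V, r ≤ T.card → T' ⊆ T ∧ T'.card = r := by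
      intro T
      by_cases h : r ≤ T.card
      · obtain ⟨T', h1, h2⟩ := Finset.exists_subset_card_eq h
        exact ⟨T', fun _ => ⟨h1, h2⟩⟩
      · exact ⟨∅, fun h' => absurd h' h⟩
    choose c hc using hc
    let F := U.powerset.filter fun T => r ≤ T.card
    have hsub : {o | ¬ Reach o v (j + 1) S U} ⊆ {o | (N o).card < r} ∪
        ⋃ T ∈ F, {o | N o = T ∧ ¬ Reach o v j (c T) (U \ c T)} := by
      intro o ho
      by_cases h : (N o).card < r
      · exact Or.inl h
      · right
        push Not at h
        simp only [Set.mem_iUnion]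
        refine ⟨N o, ?_, rfl, fun hre => ho ?_⟩
        · simp [F, h, N]
        · refine ⟨c (N o), (hc _ h).1.trans (Finset.filter_subset _ _), fun t ht => ?_, hre⟩
          exact (Finset.mem_filter.1 ((hc _ h).1 ht)).2
    set ε : ℝ := j * (2 / a) + Real.exp (-((a : ℝ) ^ (i + 1 + j) * p)) with hε
    have hε0 : 0 ≤ ε := by positivity
    have hterm : ∀ T ∈ F, μ.real {o | N o = T ∧ ¬ Reach o v j (c T) (U \ c T)} ≤
        μ.real {o | N o = T} * ε := by
      intro T hT
      obtain ⟨hTU, hTr⟩ := Finset.mem_filter.1 hT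
      rw [Finset.mem_powerset] at hTU
      obtain ⟨hcT, hcr⟩ := hc T hTr
      have hcU := hcT.trans hTU
      rw [measureReal_pi_and_of_dependsOn ρ (F := fun o => N o = T)
        (H := fun o => ¬ Reach o v j (c T) (U \ c T))
        (disjoint_edgesBetween hSU hvS (T := c T ∪ U \ c T) (W := U \ c T)
          (Finset.union_subset hcU Finset.sdiff_subset) Finset.sdiff_subset)]
      · refine mul_le_mul_of_nonneg_left ?_ measureReal_nonneg
        refine ih (i + 1) (c T) (U \ c T) Finset.disjoint_sdiff (fun h => hvU (hcU h))
          (fun h => hvU (Finset.sdiff_subset h)) (by rwa [add_assoc, add_comm 1 j]) hcr ?_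
        -- The layer removes `r ≤ M` vertices, paid for by one of the `j + 1` reserves of size `M`.
        rw [Finset.card_sdiff_of_subset hcU, hcr]
        have : u + (j + 1) * M = u + j * M + M := by ring
        omega
      · intro x y hxy
        have : N x = N y := Finset.filter_congr fun t ht =>
          iff_of_eq (dependsOn_exists_openAdj S ht hxy)
        simp only [this]
      · intro x y hxy
        simp only [dependsOn_reach v j _ _ hxy]
    -- The events `N o = T` are disjoint, so averaging the conditional error `ε` over them gives at
    -- most `ε`.
    have hsum : ∑ T ∈ F, μ.real {o | N o = T} ≤ 1 := by
      rw [← measureReal_biUnion_finset _ (fun _ _ => .of_discrete)]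
      · exact measureReal_le_one
      · intro T _ T' _ hTT'
        rw [Function.onFun, Set.disjoint_left]
        intro o h h'
        exact hTT' (h.symm.trans h')
    calc μ.real {o | ¬ Reach o v (j + 1) S U}
        ≤ μ.real {o | (N o).card < r} +
          ∑ T ∈ F, μ.real {o | N o = T ∧ ¬ Reach o v j (c T) (U \ c T)} :=
          (measureReal_mono hsub).trans ((measureReal_union_le _ _).trans
            (add_le_add_right (measureReal_biUnion_finset_le _ _) _))
      _ ≤ 2 / r + ∑ T ∈ F, μ.real {o | N o = T} * ε :=
          add_le_add hN (Finset.sum_le_sum hterm)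
      _ ≤ 2 / a + ε := by
          rw [← Finset.sum_mul]
          refine add_le_add ?_ (mul_le_of_le_one_left hε0 hsum)
          have ha' : (0 : ℝ) < a := by exact_mod_cast ha
          have : (a : ℝ) ≤ r := by exact_mod_cast Nat.le_self_pow (by omega) a
          gcongr
      _ = _ := by
          rw [hε]; push_cast
          rw [show i + 1 + j = i + (j + 1) by ring]; ring

end Exploration

/-! ### Chernoff bound and counting of walks -/

section FirstMoment

/-- Apply `1 + y ≤ exp y` at `y = -log t / (x + 1) - 1`. The resulting exponent `-x / (x + 1)`
exceeds `-1`, so the bound is integrable on `(0, 1]`, with integral `x + 1`; it replaces a Gamma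
integral. -/
lemma rpow_log_inv_le {x t : ℝ} (hx : 0 < x) (ht : 0 < t) (ht1 : t ≤ 1) :
    (-Real.log t) ^ x ≤ ((x + 1) / Real.exp 1) ^ x * t ^ (-(x / (x + 1))) := by
  have hx1 : 0 < x + 1 := by linarith
  have hu : 0 ≤ -Real.log t := by linarith [Real.log_nonpos ht.le ht1]
  have h1 : -Real.log t ≤ (x + 1) / Real.exp 1 * t ^ (-(1 / (x + 1))) := by
    have h2 := Real.add_one_le_exp (-Real.log t / (x + 1) - 1)
    rw [sub_add_cancel, Real.exp_sub, div_le_iff₀ hx1] at h2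
    rw [Real.rpow_def_of_pos ht]
    refine h2.trans (le_of_eq ?_)
    rw [show Real.log t * -(1 / (x + 1)) = -Real.log t / (x + 1) by ring]
    ring
  calc (-Real.log t) ^ x ≤ ((x + 1) / Real.exp 1 * t ^ (-(1 / (x + 1)))) ^ x :=
        Real.rpow_le_rpow hu h1 hx.le
    _ = _ := by
        rw [Real.mul_rpow (by positivity) (by positivity), ← Real.rpow_mul ht.le]
        congr 2
        field_simp

/-- A bound for the Laplace transform from a power bound on the distribution function. -/
lemma mgf_neg_le_of_cdf_le {Ω : Type*} [MeasurableSpace Ω] {μ : Measure Ω}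
    [IsProbabilityMeasure μ] {Y : Ω → ℝ} (hY : AEMeasurable Y μ) (hY0 : ∀ᵐ ω ∂μ, 0 ≤ Y ω)
    {C x θ : ℝ} (hC : 0 ≤ C) (hx : 0 < x) (hθ : 0 < θ)
    (h : ∀ y, 0 ≤ y → μ.real {ω | Y ω ≤ y} ≤ C * y ^ x) :
    mgf Y μ (-θ) ≤ C * ((x + 1) / (Real.exp 1 * θ)) ^ x * (x + 1) := by
  have hx1 : 0 < x + 1 := by linarith
  have hle : ∀ᵐ ω ∂μ, Real.exp (-θ * Y ω) ≤ 1 := by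
    filter_upwards [hY0] with ω hω
    rw [Real.exp_le_one_iff]
    nlinarith
  have hint : Integrable (fun ω => Real.exp (-θ * Y ω)) μ := by
    refine Integrable.of_bound (by fun_prop) 1 ?_
    filter_upwards [hle] with ω hω
    rwa [Real.norm_of_nonneg (Real.exp_pos _).le]
  set D : ℝ := C * ((x + 1) / (Real.exp 1 * θ)) ^ x with hD
  -- Layer-cake form: `t ≤ exp (-θ Y)` means `Y ≤ -log t / θ`, where the power bound applies.
  have htail : ∀ t ∈ Set.Ioi (0 : ℝ), μ.real {ω | t ≤ Real.exp (-θ * Y ω)} ≤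
      (Set.Ioc (0 : ℝ) 1).indicator (fun t => D * t ^ (-(x / (x + 1)))) t := by
    intro t ht
    have ht : 0 < t := ht
    by_cases ht1 : t ≤ 1
    · rw [Set.indicator_of_mem (Set.mem_Ioc.2 ⟨ht, ht1⟩)]
      have hl : 0 ≤ -Real.log t := by linarith [Real.log_nonpos ht.le ht1]
      have hset : {ω | t ≤ Real.exp (-θ * Y ω)} = {ω | Y ω ≤ -Real.log t / θ} := by
        ext ω
        rw [Set.mem_ofPred_eq, Set.mem_ofPred_eq, ← Real.log_le_iff_le_exp ht, le_div_iff₀ hθ]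
        constructor <;> intro h <;> linarith
      rw [hset]
      refine (h _ (by positivity)).trans ?_
      rw [hD, mul_assoc]
      refine mul_le_mul_of_nonneg_left ?_ hC
      rw [Real.div_rpow hl hθ.le, div_le_iff₀ (by positivity)]
      refine (rpow_log_inv_le hx ht ht1).trans (le_of_eq ?_)
      rw [← div_div, Real.div_rpow (by positivity) hθ.le]
      have : θ ^ x ≠ 0 := by positivity
      field_simp
    · rw [Set.indicator_of_notMem (fun h => ht1 h.2)]
      refine le_of_eq ?_
      rw [measureReal_def, ENNReal.toReal_eq_zero_iff]
      left
      refine measure_mono_null ?_ (ae_iff.1 hle)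
      intro ω hω hω'
      exact ht1 (le_trans hω hω')
  have hlam : -1 < -(x / (x + 1)) := by
    rw [neg_lt_neg_iff, div_lt_one hx1]; linarith
  have hpow : IntegrableOn (fun t : ℝ => t ^ (-(x / (x + 1)))) (Set.Ioc 0 1) := by
    have := intervalIntegral.intervalIntegrable_rpow' hlam (a := 0) (b := 1)
    rwa [intervalIntegrable_iff_integrableOn_Ioc_of_le zero_le_one] at this
  have hval : ∫ t in Set.Ioc (0 : ℝ) 1, t ^ (-(x / (x + 1))) = x + 1 := by
    rw [← intervalIntegral.integral_of_le zero_le_one, integral_rpow (Or.inl hlam)]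
    have h1 : -(x / (x + 1)) + 1 = 1 / (x + 1) := by field_simp; ring
    rw [h1, Real.one_rpow, Real.zero_rpow (by positivity)]
    field_simp
    ring
  have hIoi : Set.Ioc (0 : ℝ) 1 ⊆ Set.Ioi 0 := fun t ht => ht.1
  have hindI : IntegrableOn
      ((Set.Ioc (0 : ℝ) 1).indicator (fun t => D * t ^ (-(x / (x + 1))))) (Set.Ioi 0) :=
    (IntegrableOn.integrable_indicator (Integrable.const_mul hpow D) measurableSet_Ioc).integrableOn
  have hmgf : mgf Y μ (-θ) = ∫ ω, Real.exp (-θ * Y ω) ∂μ := rfl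
  rw [hmgf, hint.integral_eq_integral_meas_le (ae_of_all _ fun ω => (Real.exp_pos _).le)]
  have hanti : Antitone fun t : ℝ => μ.real {ω | t ≤ Real.exp (-θ * Y ω)} :=
    fun s t hst => measureReal_mono fun ω hω => le_trans hst hω
  calc ∫ t in Set.Ioi (0 : ℝ), μ.real {ω | t ≤ Real.exp (-θ * Y ω)}
      ≤ ∫ t in Set.Ioi (0 : ℝ),
          (Set.Ioc (0 : ℝ) 1).indicator (fun t => D * t ^ (-(x / (x + 1)))) t := by
        refine setIntegral_mono_on ?_ hindI measurableSet_Ioi htail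
        refine Integrable.mono' hindI hanti.measurable.aestronglyMeasurable ?_
        refine (ae_restrict_mem measurableSet_Ioi).mono fun t ht => ?_
        rw [Real.norm_of_nonneg measureReal_nonneg]
        exact htail t ht
    _ = D * (x + 1) := by
        rw [setIntegral_indicator measurableSet_Ioc, Set.inter_eq_right.2 hIoi,
          integral_const_mul, hval]

/-- Chernoff bound for a sum of independent variables with small lower tails. -/
lemma measureReal_sum_le_le {Ω ι : Type*} [MeasurableSpace Ω] {μ : Measure Ω}
    [IsProbabilityMeasure μ] {Y : ι → Ω → ℝ} (hind : iIndepFun Y μ)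
    (hY : ∀ i, AEMeasurable (Y i) μ) (hY0 : ∀ i, ∀ᵐ ω ∂μ, 0 ≤ Y i ω)
    {C x w : ℝ} (hC : 0 ≤ C) (hx : 0 < x) (hw : 0 < w)
    (h : ∀ i y, 0 ≤ y → μ.real {ω | Y i ω ≤ y} ≤ C * y ^ x) {A : Finset ι} (hA : A.Nonempty) :
    μ.real {ω | ∑ i ∈ A, Y i ω ≤ w} ≤
      (C * Real.exp 1 * (x + 1) * (w / A.card) ^ x) ^ A.card := by
  have hj : (0 : ℝ) < A.card := by exact_mod_cast hA.card_pos
  set j : ℝ := (A.card : ℝ) with hjdef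
  -- This `θ` minimizes `exp (θ w) * θ ^ (-x j)`, the part of the bound that depends on `θ`.
  set θ : ℝ := j * x / w with hθ
  have hθ0 : 0 < θ := by positivity
  have hint : Integrable (fun ω => Real.exp (-θ * (∑ i ∈ A, Y i) ω)) μ := by
    refine Integrable.of_bound ?_ 1 ?_
    · have : AEMeasurable (∑ i ∈ A, Y i) μ := Finset.aemeasurable_sum _ fun i _ => hY i
      fun_prop
    · filter_upwards [(Finset.eventually_all A).2 fun i _ => hY0 i] with ω hω
      rw [Real.norm_of_nonneg (Real.exp_pos _).le, Real.exp_le_one_iff, Finset.sum_apply]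
      have := Finset.sum_nonneg hω
      nlinarith
  have h1 := measure_le_le_exp_mul_mgf (X := ∑ i ∈ A, Y i) w (neg_nonpos.2 hθ0.le) hint
  rw [hind.mgf_sum₀ hY] at h1
  simp only [Finset.sum_apply] at h1
  refine h1.trans ?_
  have h2 : ∏ i ∈ A, mgf (Y i) μ (-θ) ≤
      ∏ _i ∈ A, (C * ((x + 1) / (Real.exp 1 * θ)) ^ x * (x + 1)) :=
    Finset.prod_le_prod (fun i _ => mgf_nonneg) fun i _ =>
      mgf_neg_le_of_cdf_le (hY i) (hY0 i) hC hx hθ0 (h i)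
  rw [Finset.prod_const] at h2
  have h3 : Real.exp (- -θ * w) = Real.exp x ^ A.card := by
    rw [← Real.exp_nat_mul, hθ, ← hjdef]
    congr 1
    field_simp
  rw [h3]
  refine (mul_le_mul_of_nonneg_left h2 (by positivity)).trans ?_
  rw [← mul_pow]
  refine pow_le_pow_left₀ (by positivity) ?_ _
  have h4 : (x + 1) / (Real.exp 1 * θ) = (1 + 1 / x) * (w / j) / Real.exp 1 := by
    rw [hθ]; field_simp
  have h5 : (1 + 1 / x) ^ x ≤ Real.exp 1 := by
    have h6 : 1 + 1 / x ≤ Real.exp (1 / x) := by linarith [Real.add_one_le_exp (1 / x)]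
    calc (1 + 1 / x) ^ x ≤ Real.exp (1 / x) ^ x := Real.rpow_le_rpow (by positivity) h6 hx.le
      _ = Real.exp 1 := by rw [← Real.exp_mul]; congr 1; field_simp
  rw [h4, Real.div_rpow (by positivity) (by positivity), Real.mul_rpow (by positivity)
    (by positivity), Real.exp_one_rpow]
  calc Real.exp x * (C * ((1 + 1 / x) ^ x * (w / j) ^ x / Real.exp x) * (x + 1))
      = (1 + 1 / x) ^ x * (C * (w / j) ^ x * (x + 1)) := by field_simp
    _ ≤ Real.exp 1 * (C * (w / j) ^ x * (x + 1)) := by gcongr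
    _ = _ := by ring

/-- The number of walks with `j + 1` steps between two given vertices. -/
lemma card_finsetWalkLength_succ_le {V : Type*} [Fintype V] [DecidableEq V] (G : SimpleGraph V)
    [DecidableRel G.Adj] (j : ℕ) (u v : V) :
    (G.finsetWalkLength (j + 1) u v).card ≤ Fintype.card V ^ j := by
  induction j generalizing u with
  | zero =>
    rw [pow_zero, Finset.card_le_one]
    intro p hp q hq
    rw [SimpleGraph.mem_finsetWalkLength_iff] at hp hq
    cases p with
    | nil => simp at hp
    | cons h p =>
      cases q with
      | nil => simp at hq
      | cons h' q =>
        cases p with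
        | cons _ _ => simp at hp
        | nil =>
          cases q with
          | cons _ _ => simp at hq
          | nil => rfl
  | succ j ih =>
    rw [SimpleGraph.finsetWalkLength]
    refine Finset.card_biUnion_le.trans ?_
    simp only [Finset.card_map]
    refine (Finset.sum_le_card_nsmul _ _ _ fun w _ => ih _).trans ?_
    rw [smul_eq_mul, pow_succ']
    exact Nat.mul_le_mul_right _ (by
      rw [Finset.card_univ, SimpleGraph.card_neighborSet_eq_degree]
      exact (G.degree_lt_card_verts u).le)

end FirstMoment

/-! ### From path weights to the hopcount -/

section Hopcount

/-- If some path has weight at most `w`, then the hopcount is the length of such a path. -/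
lemma exists_path_length_eq_hopcountBetween {V : Type*} [Finite V] {G : SimpleGraph V}
    {c : Sym2 V → ℝ} {u v : V} {w : ℝ} (h : ∃ p : G.Path u v, pathWeight c p ≤ w) :
    ∃ p : G.Path u v, pathWeight c p ≤ w ∧ p.1.length = hopcountBetween G c u v := by
  classical
  have := Fintype.ofFinite V
  obtain ⟨p₀, hp₀⟩ := h
  have : Nonempty (G.Path u v) := ⟨p₀⟩
  obtain ⟨p, hp⟩ := Finite.exists_min (fun p : G.Path u v => pathWeight c p)
  obtain ⟨q, hq, hql⟩ := Nat.sInf_mem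
    (s := {k : ℕ | ∃ p : G.Path u v, IsOptimalPath c p ∧ p.1.length = k}) ⟨_, p, hp, rfl⟩
  exact ⟨q, (hq p₀).trans hp₀, hql⟩

/-- Light edges along a walk give a light path. -/
lemma exists_path_weight_le {V : Type*} [DecidableEq V] {G : SimpleGraph V}
    {c : Sym2 V → ℝ} {u v : V} (p : G.Walk u v) {τ : ℝ} (hτ : 0 ≤ τ)
    (h : ∀ e ∈ p.edges, c e ≤ τ) : ∃ q : G.Path u v, pathWeight c q ≤ p.length * τ := by
  refine ⟨p.toPath, ?_⟩
  have h1 : pathWeight c p.toPath ≤ (p.bypass.edges.map c).length • τ := by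
    refine List.sum_le_card_nsmul _ _ fun x hx => ?_
    obtain ⟨e, he, rfl⟩ := List.mem_map.1 hx
    exact h e (p.edges_bypass_subset_edges he)
  rw [List.length_map, SimpleGraph.Walk.length_edges, nsmul_eq_mul] at h1
  refine h1.trans ?_
  have : (p.bypass.length : ℝ) ≤ p.length := by exact_mod_cast p.length_bypass_le_length
  gcongr

variable {Ω : Type*} [MeasurableSpace Ω] {μ : Measure Ω} [IsProbabilityMeasure μ]

/-- Chernoff bound for the weight of one path. -/
lemma measureReal_pathWeight_le_le {V : Type*} {X : Sym2 V → Ω → ℝ}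
    (hind : iIndepFun (fun e : (⊤ : SimpleGraph V).edgeSet => X e) μ)
    (hX : ∀ e ∈ (⊤ : SimpleGraph V).edgeSet, AEMeasurable (X e) μ)
    (hX0 : ∀ e ∈ (⊤ : SimpleGraph V).edgeSet, ∀ᵐ ω ∂μ, 0 ≤ X e ω)
    {C x w : ℝ} (hC : 0 ≤ C) (hx : 0 < x) (hw : 0 < w)
    (h : ∀ e ∈ (⊤ : SimpleGraph V).edgeSet, ∀ y, 0 ≤ y → μ.real {ω | X e ω ≤ y} ≤ C * y ^ x)
    {u v : V} (huv : u ≠ v) (p : (⊤ : SimpleGraph V).Path u v) :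
    μ.real {ω | pathWeight (fun e => X e ω) p ≤ w} ≤
      (C * Real.exp 1 * (x + 1) * (w / p.1.length) ^ x) ^ p.1.length := by
  classical
  have hnd : p.1.edges.Nodup := p.2.isTrail.edges_nodup
  let A : Finset (⊤ : SimpleGraph V).edgeSet := p.1.edges.toFinset.subtype (· ∈ _)
  have hmem : ∀ e ∈ p.1.edges.toFinset, e ∈ (⊤ : SimpleGraph V).edgeSet := fun e he =>
    p.1.edges_subset_edgeSet (List.mem_toFinset.1 he)
  have hcard : A.card = p.1.length := by
    rw [Finset.card_subtype, Finset.filter_true_of_mem hmem, List.toFinset_card_of_nodup hnd,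
      SimpleGraph.Walk.length_edges]
  have hne : A.Nonempty := by
    rw [← Finset.card_pos, hcard, Nat.pos_iff_ne_zero]
    exact fun h0 => huv (SimpleGraph.Walk.eq_of_length_eq_zero h0)
  have hsum (ω : Ω) : pathWeight (fun e => X e ω) p = ∑ e ∈ A, X e ω := by
    rw [pathWeight, ← List.sum_toFinset _ hnd]
    exact (Finset.sum_subtype_of_mem (fun e => X e ω) hmem).symm
  simp only [hsum]
  rw [← hcard]
  exact measureReal_sum_le_le hind (fun e => hX e e.2) (fun e => hX0 e e.2) hC hx hw
    (fun e => h e e.2) hne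

/-- First moment bound for the existence of a light path of a given kind of length. -/
lemma measureReal_exists_path_le {V : Type*} [Fintype V] {X : Sym2 V → Ω → ℝ}
    (hind : iIndepFun (fun e : (⊤ : SimpleGraph V).edgeSet => X e) μ)
    (hX : ∀ e ∈ (⊤ : SimpleGraph V).edgeSet, AEMeasurable (X e) μ)
    (hX0 : ∀ e ∈ (⊤ : SimpleGraph V).edgeSet, ∀ᵐ ω ∂μ, 0 ≤ X e ω)
    {C x w : ℝ} (hC : 0 ≤ C) (hx : 0 < x) (hw : 0 < w)
    (h : ∀ e ∈ (⊤ : SimpleGraph V).edgeSet, ∀ y, 0 ≤ y → μ.real {ω | X e ω ≤ y} ≤ C * y ^ x)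
    {u v : V} (huv : u ≠ v) {J : Set ℕ} {r : ℝ} (hr0 : 0 ≤ r) (hr : r ≤ 1 / 2)
    (hJ : ∀ j ∈ J, 1 ≤ j → (Fintype.card V : ℝ) ^ (j - 1) *
      (C * Real.exp 1 * (x + 1) * (w / j) ^ x) ^ j ≤ r ^ j) :
    μ.real {ω | ∃ p : (⊤ : SimpleGraph V).Path u v, p.1.length ∈ J ∧
      pathWeight (fun e => X e ω) p ≤ w} ≤ 2 * r := by
  classical
  let N := Fintype.card V
  -- The index is shifted: `W j` holds paths with `j + 1` edges, since `u ≠ v` excludes length `0`.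
  let W (j : ℕ) := ((⊤ : SimpleGraph V).finsetWalkLength (j + 1) u v).filter fun p => p.IsPath
  have hsub : {ω | ∃ p : (⊤ : SimpleGraph V).Path u v, p.1.length ∈ J ∧
      pathWeight (fun e => X e ω) p ≤ w} ⊆
      ⋃ j ∈ (Finset.range N).filter (fun j => j + 1 ∈ J), ⋃ p ∈ (W j).attach,
        {ω | pathWeight (fun e => X e ω) ⟨p.1, (Finset.mem_filter.1 p.2).2⟩ ≤ w} := by
    rintro ω ⟨p, hpJ, hpw⟩
    have hp0 : p.1.length ≠ 0 := fun h0 => huv (SimpleGraph.Walk.eq_of_length_eq_zero h0)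
    obtain ⟨j, hj⟩ := Nat.exists_eq_succ_of_ne_zero hp0
    have hjN : j < N := by
      have := p.2.length_lt
      omega
    have hpW : p.1 ∈ W j := Finset.mem_filter.2
      ⟨SimpleGraph.mem_finsetWalkLength_iff.2 hj, p.2⟩
    simp only [Set.mem_iUnion]
    exact ⟨j, by simpa [hjN, hj] using hpJ, ⟨p.1, hpW⟩, Finset.mem_attach _ _, hpw⟩
  refine (measureReal_mono hsub (measure_ne_top _ _)).trans ((measureReal_biUnion_finset_le _ _).trans ?_)
  have hj : ∀ j ∈ (Finset.range N).filter (fun j => j + 1 ∈ J),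
      μ.real (⋃ p ∈ (W j).attach,
        {ω | pathWeight (fun e => X e ω) ⟨p.1, (Finset.mem_filter.1 p.2).2⟩ ≤ w}) ≤
        r ^ (j + 1) := by
    intro j hj
    have hjJ := (Finset.mem_filter.1 hj).2
    refine (measureReal_biUnion_finset_le _ _).trans ?_
    set B : ℝ := (C * Real.exp 1 * (x + 1) * (w / ((j + 1 : ℕ) : ℝ)) ^ x) ^ (j + 1) with hB
    have hB0 : 0 ≤ B := by positivity
    refine (Finset.sum_le_card_nsmul _ _ B fun p _ => ?_).trans ?_
    · have h1 := measureReal_pathWeight_le_le hind hX hX0 hC hx hw h huv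
        ⟨p.1, (Finset.mem_filter.1 p.2).2⟩
      have h2 : p.1.length = j + 1 :=
        SimpleGraph.mem_finsetWalkLength_iff.1 (Finset.mem_filter.1 p.2).1
      simp only [h2] at h1
      exact h1
    · rw [Finset.card_attach, nsmul_eq_mul]
      refine le_trans ?_ (hJ (j + 1) hjJ (by omega))
      rw [Nat.add_sub_cancel]
      refine mul_le_mul_of_nonneg_right ?_ hB0
      exact_mod_cast (Finset.card_filter_le _ _).trans (card_finsetWalkLength_succ_le _ j u v)
  refine (Finset.sum_le_sum hj).trans ?_
  have hsumm : Summable fun j : ℕ => r ^ (j + 1) := by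
    simp only [pow_succ]
    exact (summable_geometric_of_lt_one hr0 (by linarith)).mul_right r
  refine (hsumm.sum_le_tsum _ fun j _ => by positivity).trans ?_
  simp only [pow_succ]
  rw [tsum_mul_right, tsum_geometric_of_lt_one hr0 (by linarith)]
  have : (1 - r)⁻¹ ≤ 2 := by
    rw [inv_le_comm₀ (by linarith) (by norm_num)]; linarith
  gcongr

/-- With high probability there is a path all of whose edges have weight at most `τ`. -/
lemma measureReal_forall_path_gt_le {n : ℕ} {X : Sym2 (Fin n) → Ω → ℝ}
    (hind : iIndepFun (fun e : (⊤ : SimpleGraph (Fin n)).edgeSet => X e) μ)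
    (hX : ∀ e ∈ (⊤ : SimpleGraph (Fin n)).edgeSet, AEMeasurable (X e) μ) {τ p : ℝ} (hτ : 0 ≤ τ)
    (hp : ∀ e ∈ (⊤ : SimpleGraph (Fin n)).edgeSet, p ≤ μ.real {ω | X e ω ≤ τ})
    {a u M j : ℕ} (ha : 1 ≤ a) (hu : 0 < u) (hup : u * p = 4 * a) (hM : 4 * M ≤ u)
    (haM : a ^ j ≤ M) (hn : u + j * M + 2 ≤ n) {v v' : Fin n} (hvv : v ≠ v') :
    μ.real {ω | ¬ ∃ q : (⊤ : SimpleGraph (Fin n)).Path v v',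
      pathWeight (fun e => X e ω) q ≤ (j + 1) * τ} ≤
      j * (2 / a) + Real.exp (-((a : ℝ) ^ j * p)) := by
  let ξ (e : (⊤ : SimpleGraph (Fin n)).edgeSet) (ω : Ω) : Prop := X e ω ≤ τ
  have hφ : Measurable fun x : ℝ => x ≤ τ := measurableSet_setOfPred.1 measurableSet_Iic
  have hξ (e) : AEMeasurable (ξ e) μ := hφ.comp_aemeasurable (hX e e.2)
  have hξind : iIndepFun ξ μ := hind.comp (fun _ x => x ≤ τ) (fun _ => hφ)
  -- By independence the configuration of open edges has a product law, so the exploration bound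
  -- transfers.
  have hmap := hξind.map_fun_eq_pi_map hξ
  have hprob (e) : IsProbabilityMeasure (μ.map (ξ e)) := Measure.isProbabilityMeasure_map (hξ e)
  have hp' : ∀ e, p ≤ (μ.map (ξ e)).real {True} := by
    intro e
    rw [map_measureReal_apply_of_aemeasurable (hξ e) .of_discrete]
    refine (hp e e.2).trans (le_of_eq ?_)
    congr 1
    ext ω
    simp [ξ]
  have h := measureReal_not_reach_le (fun e => μ.map (ξ e)) hp' ha hu hup hM v' j 0 {v}
    (Finset.univ \ {v, v'}) (by simp) (by simpa using hvv.symm) (by simp) (by simpa using haM)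
    (by simp) (by
      rw [Finset.card_sdiff_of_subset (Finset.subset_univ _), Finset.card_pair hvv,
        Finset.card_univ, Fintype.card_fin]
      omega)
  rw [← hmap, map_measureReal_apply_of_aemeasurable (aemeasurable_pi_lambda _ hξ) .of_discrete,
    zero_add] at h
  refine (measureReal_mono ?_).trans h
  intro ω hω hre
  refine hω ?_
  obtain ⟨a, ha, q, hq, hqe⟩ := hre.exists_walk
  rw [Finset.mem_singleton] at ha
  subst ha
  obtain ⟨q', hq'⟩ := exists_path_weight_le (c := fun e => X e ω) q hτ fun e he => (hqe e he).2
  refine ⟨q', hq'.trans (le_of_eq ?_)⟩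
  rw [hq]
  push_cast
  ring

/-- The probability that the hopcount lies in a set `J` of atypical values. -/
theorem measureReal_hopcount_mem_le {n : ℕ} (hn2 : 2 ≤ n) {X : Sym2 (Fin n) → Ω → ℝ}
    (hind : iIndepFun (fun e : (⊤ : SimpleGraph (Fin n)).edgeSet => X e) μ)
    (hX : ∀ e ∈ (⊤ : SimpleGraph (Fin n)).edgeSet, AEMeasurable (X e) μ)
    (hX0 : ∀ e ∈ (⊤ : SimpleGraph (Fin n)).edgeSet, ∀ᵐ ω ∂μ, 0 ≤ X e ω)
    {C x : ℝ} (hC : 0 ≤ C) (hx : 0 < x)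
    (h : ∀ e ∈ (⊤ : SimpleGraph (Fin n)).edgeSet, ∀ y, 0 ≤ y →
      μ.real {ω | X e ω ≤ y} ≤ C * y ^ x)
    {τ p : ℝ} (hτ : 0 < τ)
    (hp : ∀ e ∈ (⊤ : SimpleGraph (Fin n)).edgeSet, p ≤ μ.real {ω | X e ω ≤ τ})
    {a u M k : ℕ} (ha : 1 ≤ a) (hu : 0 < u) (hup : u * p = 4 * a) (hM : 4 * M ≤ u)
    (haM : a ^ k ≤ M) (hn : u + k * M + 2 ≤ n)
    {J : Set ℕ} {r : ℝ} (hr0 : 0 ≤ r) (hr : r ≤ 1 / 2)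
    (hJ : ∀ j ∈ J, 1 ≤ j → (n : ℝ) ^ (j - 1) *
      (C * Real.exp 1 * (x + 1) * ((k + 1) * τ / j) ^ x) ^ j ≤ r ^ j) :
    μ.real {ω | hopcount n (fun e => X e ω) ∈ J} ≤
      2 * r + (k * (2 / a) + Real.exp (-((a : ℝ) ^ k * p))) := by
  have hne : (⟨0, by omega⟩ : Fin n) ≠ ⟨1, by omega⟩ := by simp
  have h1 := measureReal_exists_path_le hind hX hX0 hC hx
    (by positivity : 0 < ((k : ℝ) + 1) * τ) h hne hr0 hr (by simpa using hJ)
  have h2 := measureReal_forall_path_gt_le hind hX hτ.le hp ha hu hup hM haM hn hne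
  refine le_trans ?_ (add_le_add h1 h2)
  refine (measureReal_mono fun ω hω => ?_).trans (measureReal_union_le _ _)
  by_cases hq : ∃ q : (⊤ : SimpleGraph (Fin n)).Path ⟨0, by omega⟩ ⟨1, by omega⟩,
      pathWeight (fun e => X e ω) q ≤ (k + 1) * τ
  · left
    obtain ⟨q, hq, hql⟩ := exists_path_length_eq_hopcountBetween hq
    refine ⟨q, ?_, hq⟩
    rw [hql]
    simpa [hopcount, hn2] using hω
  · exact Or.inr hq

end Hopcount

/-! ### Analytic estimates and choice of parameters -/

section Estimates

/-- Each summand of the first moment is bounded by the power of an exponentially small number. -/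
lemma pow_mul_rpow_pow_le {n j k : ℕ} (hn : 1 ≤ n) (hj : 1 ≤ j) (hk : 1 ≤ k)
    {s K A z Δ : ℝ} (hs : 0 < s) (hs1 : s ≤ 1) (hK : 0 ≤ K) (hz0 : 0 < z)
    (hz : z ≤ A * (n : ℝ) ^ (1 / (k : ℝ) - 1))
    (hΔ : Δ ≤ (s * Real.log n / j + Real.log j - (s * Real.log n / k + Real.log k)) / s -
      Real.log (1 / s)) :
    (n : ℝ) ^ (j - 1) * (K * (1 / s + 1) * (k * z ^ s / j) ^ (1 / s)) ^ j ≤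
      (2 * K * A * Real.exp (-Δ)) ^ j := by
  have hn0 : (0 : ℝ) < n := by exact_mod_cast hn
  have hj0 : (0 : ℝ) < j := by exact_mod_cast hj
  have hk0 : (0 : ℝ) < k := by exact_mod_cast hk
  have e1 : (n : ℝ) ^ (j - 1) = Real.exp (Real.log n * (1 - 1 / j)) ^ j := by
    rw [← Real.exp_nat_mul, ← Real.rpow_natCast, Real.rpow_def_of_pos hn0, Nat.cast_sub hj]
    congr 1
    push_cast
    field_simp
  have e2 : ((k : ℝ) * z ^ s / j) ^ (1 / s) =
      Real.exp ((Real.log k - Real.log j) / s) * z := by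
    rw [mul_div_right_comm, Real.mul_rpow (by positivity) (by positivity),
      ← Real.rpow_mul hz0.le, mul_one_div_cancel hs.ne', Real.rpow_one,
      Real.rpow_def_of_pos (by positivity), Real.log_div hk0.ne' hj0.ne', mul_one_div]
  have e3 : (n : ℝ) ^ (1 / (k : ℝ) - 1) = Real.exp (Real.log n * (1 / k - 1)) :=
    Real.rpow_def_of_pos hn0 _
  -- The Chernoff factor `x + 1` with `x = 1 / s` is the source of the term `log (1 / s)` in the
  -- exponent.
  have e4 : 1 / s + 1 ≤ 2 * Real.exp (Real.log (1 / s)) := by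
    rw [Real.exp_log (by positivity)]
    have : 1 ≤ 1 / s := by rw [le_div_iff₀ hs]; linarith
    linarith
  rw [e1, e2, ← mul_pow]
  refine pow_le_pow_left₀ (by positivity) ?_ _
  rw [e3] at hz
  have hA : 0 ≤ A := by
    by_contra! hA
    have : A * Real.exp (Real.log n * (1 / k - 1)) < 0 :=
      mul_neg_of_neg_of_pos hA (Real.exp_pos _)
    linarith
  calc Real.exp (Real.log n * (1 - 1 / j)) *
        (K * (1 / s + 1) * (Real.exp ((Real.log k - Real.log j) / s) * z))
      ≤ Real.exp (Real.log n * (1 - 1 / j)) *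
        (K * (2 * Real.exp (Real.log (1 / s))) * (Real.exp ((Real.log k - Real.log j) / s) *
          (A * Real.exp (Real.log n * (1 / k - 1))))) := by gcongr
    _ = 2 * K * A * Real.exp (Real.log n * (1 - 1 / j) + Real.log (1 / s) +
          (Real.log k - Real.log j) / s + Real.log n * (1 / k - 1)) := by
        simp only [Real.exp_add]; ring
    _ ≤ 2 * K * A * Real.exp (-Δ) := by
        gcongr
        have : (s * Real.log n / j + Real.log j - (s * Real.log n / k + Real.log k)) / s =
          Real.log n / j - Real.log n / k + (Real.log j - Real.log k) / s := by
          field_simp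
          ring
        rw [this] at hΔ
        have h1 : (Real.log k - Real.log j) / s = - ((Real.log j - Real.log k) / s) := by ring
        rw [h1]
        have h2 : Real.log n * (1 - 1 / j) + Real.log n * (1 / k - 1) =
          Real.log n / k - Real.log n / j := by ring
        linarith

/-- `y - 1 - log y` grows at least like `(y - 1) ^ 2 / 2` near `1`, and is monotone on both
sides. -/
lemma sq_half_sub_le_sub_log {b y : ℝ} (hb0 : 0 ≤ b) (hb : b ≤ 1 / 2) (hy0 : 0 < y)
    (hy : 1 + b ≤ y ∨ y ≤ 1 - b) : b ^ 2 / 2 - 2 * b ^ 3 ≤ y - 1 - Real.log y := by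
  rcases hy with hy | hy
  · have h1 := Real.abs_log_sub_add_sum_range_le (x := -b) (by rw [abs_neg, abs_of_nonneg hb0]; linarith) 2
    rw [abs_neg, abs_of_nonneg hb0] at h1
    have h2 : b ^ 3 / (1 - b) ≤ 2 * b ^ 3 := by
      rw [div_le_iff₀ (by linarith)]
      nlinarith [pow_nonneg hb0 3]
    have h3 := (abs_le.1 h1).2
    simp [Finset.sum_range_succ] at h3
    -- Monotonicity beyond `1 + b` without calculus: comparing `log y` with `log (1 + b)` reduces
    -- the claim to the Taylor bound at `1 + b`.
    have h4 := Real.log_le_sub_one_of_pos (show 0 < y / (1 + b) by positivity)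
    rw [Real.log_div (by positivity) (by positivity)] at h4
    have h5 : y / (1 + b) - 1 ≤ y - (1 + b) := by
      rw [sub_le_iff_le_add, div_le_iff₀ (by linarith)]
      nlinarith
    ring_nf at h3 h2 h4 h5 ⊢
    linarith
  · have h1 := Real.abs_log_sub_add_sum_range_le (x := b) (by rw [abs_of_nonneg hb0]; linarith) 2
    rw [abs_of_nonneg hb0] at h1
    have h2 : b ^ 3 / (1 - b) ≤ 2 * b ^ 3 := by
      rw [div_le_iff₀ (by linarith)]
      nlinarith [pow_nonneg hb0 3]
    have h3 := (abs_le.1 h1).2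
    simp [Finset.sum_range_succ] at h3
    have h4 := Real.log_le_sub_one_of_pos (show 0 < y / (1 - b) by
      have : 0 < 1 - b := by linarith
      positivity)
    rw [Real.log_div (by positivity) (by linarith)] at h4
    have h5 : y / (1 - b) - 1 ≤ y - (1 - b) := by
      rw [sub_le_iff_le_add, div_le_iff₀ (by linarith)]
      nlinarith
    have h6 := pow_nonneg hb0 3
    have h7 := pow_nonneg hb0 2
    ring_nf at h3 h2 h4 h5 ⊢
    linarith

/-- Rounding costs only second order, `l` being the minimizer: `log x ≥ 1 - 1 / x` at `x = l / k`
leaves `(l - k) ^ 2 / (l * k)`. -/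
lemma sub_log_floor_le {l k : ℝ} (hk : 0 < k) (hkl : k ≤ l) (hlk : l ≤ 2 * k) :
    l / k - 1 - Real.log (l / k) ≤ 4 * ((l - k) / l) ^ 2 := by
  have hl : 0 < l := by linarith
  have h1 := Real.one_sub_inv_le_log_of_pos (show 0 < l / k by positivity)
  have h2 : l / k - 1 - (1 - (l / k)⁻¹) = (l - k) ^ 2 / (l * k) := by
    field_simp
  have h3 : (l - k) ^ 2 / (l * k) ≤ 4 * ((l - k) / l) ^ 2 := by
    rw [div_pow, ← mul_div_assoc, div_le_div_iff₀ (by positivity) (by positivity)]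
    have : 0 ≤ (l - k) ^ 2 * l * (4 * k - l) := by
      have : 0 ≤ 4 * k - l := by linarith
      positivity
    nlinarith
  linarith

/-- Parameters for the exploration. -/
lemma exists_exploration_parameters {n : ℕ} {s : ℝ} (hs : 0 < s)
    (hL : 2 ≤ s * Real.log n) (hsL : 6 * (s * (s * Real.log n)) ≤ 1) {k : ℕ}
    (hk : k + 1 = ⌊s * Real.log n⌋₊) :
    ∃ (a u : ℕ) (p : ℝ), 1 ≤ a ∧ 0 < u ∧ u * p = 4 * a ∧ 4 * a ^ k ≤ u ∧
      u + k * a ^ k + 2 ≤ n ∧ 0 < p ∧ p ≤ 48 * (n : ℝ) ^ (1 / ((k + 1 : ℕ) : ℝ) - 1) ∧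
      k * (2 / (a : ℝ)) + Real.exp (-((a : ℝ) ^ k * p)) ≤ 2 * Real.exp (1 - s * Real.log n) := by
  set L := s * Real.log n with hLdef
  set κ : ℝ := ((k + 1 : ℕ) : ℝ) with hκ
  have hκk : κ = k + 1 := by rw [hκ]; push_cast; ring
  have hκL : κ ≤ L := by rw [hκ, hk]; exact Nat.floor_le (by linarith)
  have hLκ : L < κ + 1 := by rw [hκ, hk]; exact Nat.lt_floor_add_one L
  have hκ0 : 0 < κ := by linarith
  have hlog : 0 < Real.log n := by
    by_contra! h
    nlinarith
  have hn1 : 1 < n := by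
    by_contra! h
    interval_cases n <;> simp at hlog
  have hn0 : (0 : ℝ) < n := by positivity
  set y : ℝ := (n : ℝ) ^ (1 / κ) with hy
  have hy0 : 0 < y := by positivity
  have hyκ : y ^ (k + 1) = n := by
    rw [hy, ← Real.rpow_natCast, ← Real.rpow_mul hn0.le, ← hκ, one_div_mul_cancel hκ0.ne',
      Real.rpow_one]
  -- `s * L ≤ 1 / 6` gives `log n = L / s ≥ 6 * L ^ 2`, and dividing by `κ ≤ L` leaves at least `6 *
  -- L`.
  have hye : Real.exp (6 * L) ≤ y := by
    rw [hy, Real.rpow_def_of_pos hn0, Real.exp_le_exp, mul_one_div, le_div_iff₀ hκ0]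
    have h1 : 6 * (s * (L * L)) ≤ s * Real.log n := by
      rw [← hLdef]; nlinarith
    have h2 : 6 * (L * L) ≤ Real.log n := by
      by_contra! h
      nlinarith
    nlinarith
  have hy1 : 1 ≤ y := (Real.one_le_exp (by linarith)).trans hye
  set a := ⌈2 * y⌉₊ with ha
  have ha2 : 2 * y ≤ a := Nat.le_ceil _
  have ha3 : (a : ℝ) ≤ 3 * y := by
    have := Nat.ceil_lt_add_one (show 0 ≤ 2 * y by positivity)
    linarith
  have ha0 : (0 : ℝ) < a := by linarith
  have ha1 : 1 ≤ a := by exact_mod_cast ha0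
  set u := n / 2 with hu
  have hu0 : 0 < u := by omega
  have hu0' : (0 : ℝ) < u := by exact_mod_cast hu0
  have hu4 : (n : ℝ) ≤ 4 * u := by
    have : n ≤ 4 * u := by omega
    exact_mod_cast this
  have hu2 : 2 * (u : ℝ) ≤ n := by
    have : 2 * u ≤ n := by omega
    exact_mod_cast this
  -- Room for all layers: `a ^ k` is at most of order `3 ^ k * n / y`, and `y ≥ exp (6 * L)` absorbs
  -- `(k + 4) * 3 ^ (k + 1)`.
  have hmain : (2 * k + 8) * a ^ k ≤ n := by
    have h1 : (a : ℝ) ^ k * (2 * y) ≤ 3 ^ (k + 1) * n := by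
      calc (a : ℝ) ^ k * (2 * y) ≤ a ^ k * a := by gcongr
        _ = a ^ (k + 1) := (pow_succ _ _).symm
        _ ≤ (3 * y) ^ (k + 1) := by gcongr
        _ = 3 ^ (k + 1) * n := by rw [mul_pow, hyκ]
    have h2 : ((k : ℝ) + 4) * 3 ^ (k + 1) ≤ y := by
      have h3 : (3 : ℝ) ^ (k + 1) ≤ Real.exp (2 * κ) := by
        have : (3 : ℝ) ≤ Real.exp 2 := by linarith [Real.add_one_le_exp (2 : ℝ)]
        calc (3 : ℝ) ^ (k + 1) ≤ Real.exp 2 ^ (k + 1) := by gcongr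
          _ = Real.exp (2 * κ) := by rw [← Real.exp_nat_mul, ← hκ, mul_comm]
      have h4 : (k : ℝ) + 4 ≤ Real.exp (k + 3) := by
        linarith [Real.add_one_le_exp ((k : ℝ) + 3)]
      calc ((k : ℝ) + 4) * 3 ^ (k + 1) ≤ Real.exp (k + 3) * Real.exp (2 * κ) := by gcongr
        _ = Real.exp (k + 3 + 2 * κ) := (Real.exp_add _ _).symm
        _ ≤ Real.exp (6 * L) := by rw [Real.exp_le_exp]; linarith
        _ ≤ y := hye
    have h5 : ((2 * k + 8) * a ^ k : ℝ) * y ≤ n * y := by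
      calc ((2 * k + 8) * a ^ k : ℝ) * y = (k + 4) * (a ^ k * (2 * y)) := by ring
        _ ≤ (k + 4) * (3 ^ (k + 1) * n) := by gcongr
        _ = ((k + 4) * 3 ^ (k + 1)) * n := by ring
        _ ≤ y * n := by gcongr
        _ = n * y := mul_comm _ _
    have h6 := le_of_mul_le_mul_right h5 hy0
    exact_mod_cast h6
  have hak : 1 ≤ a ^ k := Nat.one_le_pow _ _ ha1
  have hexp : (2 * k + 8) * a ^ k = 2 * (k * a ^ k) + 8 * a ^ k := by ring
  refine ⟨a, u, 4 * a / u, ha1, hu0, by field_simp, by omega, by omega, by positivity, ?_, ?_⟩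
  · rw [Real.rpow_sub hn0, Real.rpow_one, ← hy, ← mul_div_assoc,
      div_le_div_iff₀ hu0' hn0]
    calc 4 * (a : ℝ) * n ≤ 4 * (3 * y) * (4 * u) := by gcongr
      _ = 48 * y * u := by ring
  · have h1 : (k : ℝ) * (2 / a) ≤ Real.exp (1 - L) := by
      calc (k : ℝ) * (2 / a) ≤ k * (2 / (2 * y)) := by gcongr
        _ = k / y := by field_simp
        _ ≤ Real.exp L / Real.exp (6 * L) := by
            gcongr
            linarith [Real.add_one_le_exp L]
        _ = Real.exp (L - 6 * L) := (Real.exp_sub _ _).symm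
        _ ≤ Real.exp (1 - L) := by rw [Real.exp_le_exp]; linarith
    -- The factor `2` in `a ≥ 2 * y` pays off here: `a ^ (k + 1) ≥ 2 ^ (k + 1) * n` makes the
    -- expected number of open edges to the target grow.
    have h2 : L - 1 ≤ (a : ℝ) ^ k * (4 * a / u) := by
      have h3 : (2 : ℝ) ^ (k + 1) * n ≤ a ^ (k + 1) := by
        rw [← hyκ, ← mul_pow]; gcongr
      have h4 : κ ≤ (2 : ℝ) ^ (k + 1) := by
        rw [hκ]; exact_mod_cast Nat.lt_two_pow_self.le
      calc L - 1 ≤ κ := by linarith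
        _ ≤ (2 : ℝ) ^ (k + 1) := h4
        _ ≤ a ^ (k + 1) / u := by
            rw [le_div_iff₀ hu0']
            refine le_trans ?_ h3
            gcongr
            omega
        _ ≤ 4 * (a ^ (k + 1) / u) := by
            have : (0 : ℝ) ≤ a ^ (k + 1) / u := by positivity
            linarith
        _ = _ := by rw [pow_succ]; ring
    have h5 : Real.exp (-((a : ℝ) ^ k * (4 * a / u))) ≤ Real.exp (1 - L) := by
      rw [Real.exp_le_exp]; linarith
    linarith

/-- Linear bounds on a bounded function near a point where it has a positive derivative. -/
lemma exists_linear_bounds {F : ℝ → ℝ} {b : ℝ} (hb : 0 < b)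
    (hF : DifferentiableWithinAt ℝ F (Set.Icc 0 b) 0)
    (hF' : 0 < derivWithin F (Set.Icc 0 b) 0) (hF0 : F 0 = 0) (hF1 : ∀ x, F x ≤ 1) :
    ∃ c C x₀ : ℝ, 0 < c ∧ 0 < C ∧ 0 < x₀ ∧ (∀ x, 0 ≤ x → x ≤ x₀ → c * x ≤ F x) ∧
      ∀ x, 0 ≤ x → F x ≤ C * x := by
  set d := derivWithin F (Set.Icc 0 b) 0 with hd
  have h := hF.hasDerivWithinAt
  rw [← hd, hasDerivWithinAt_iff_tendsto_slope] at h
  have h1 := h.eventually (Icc_mem_nhds (show d / 2 < d by linarith) (show d < 2 * d by linarith))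
  rw [eventually_nhdsWithin_iff, Metric.eventually_nhds_iff] at h1
  obtain ⟨ε, hε, h1⟩ := h1
  set x₀ := min b (ε / 2) with hx₀
  have hx₀0 : 0 < x₀ := lt_min hb (by positivity)
  have hx₀ε : x₀ < ε := (min_le_right _ _).trans_lt (by linarith)
  have key : ∀ x, 0 ≤ x → x ≤ x₀ → d / 2 * x ≤ F x ∧ F x ≤ 2 * d * x := by
    intro x hx hxx
    rcases hx.eq_or_lt with rfl | hx
    · simp [hF0]
    · have h2 := h1 (y := x) (by rw [Real.dist_eq, sub_zero, abs_of_pos hx]; linarith)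
        ⟨⟨hx.le, hxx.trans (min_le_left _ _)⟩, hx.ne'⟩
      rw [slope_def_field, hF0, sub_zero, sub_zero, le_div_iff₀ hx,
        div_le_iff₀ hx] at h2
      exact h2
  -- Beyond `x₀` the slope `1 / x₀` suffices, because `F ≤ 1`.
  refine ⟨d / 2, max (2 * d) (1 / x₀), x₀, by positivity, by positivity, hx₀0,
    fun x hx hxx => (key x hx hxx).1, fun x hx => ?_⟩
  rcases le_total x x₀ with hxx | hxx
  · exact (key x hx hxx).2.trans (by gcongr; exact le_max_left _ _)
  · refine (hF1 x).trans ?_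
    calc (1 : ℝ) ≤ 1 / x₀ * x := by rw [one_div_mul_eq_div, le_div_iff₀ hx₀0]; linarith
      _ ≤ _ := by gcongr; exact le_max_right _ _

end Estimates

/-! ### Comparison of exponents and conclusion -/

section Main

/-- The loss in the exponent for path lengths `j` away from the optimal one. -/
lemma mul_log_inv_le_exponent {s L b δ : ℝ} {j k : ℕ} (hs : 0 < s) (hs1 : s ≤ 1) (hδ : 0 < δ)
    (hb0 : 0 < b) (hb : b ≤ 1 / 2) (hbδ : b ≤ δ / 16) (hL : 2 ≤ L) (hj : 1 ≤ j)
    (hk : k = ⌊L⌋₊) (hkb : (L - k) / L ≤ min 1 δ / 8 * b)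
    (hsb : s * Real.log (1 / s) ≤ (1 / 2 - δ / 2) * b ^ 2)
    (hjb : 1 + b ≤ L / j ∨ L / j ≤ 1 - b) :
    δ / 2 * Real.log (1 / s) ≤
      (L / j + Real.log j - (L / k + Real.log k)) / s - Real.log (1 / s) := by
  have hj0 : (0 : ℝ) < j := by exact_mod_cast hj
  have hkL : (k : ℝ) ≤ L := by rw [hk]; exact Nat.floor_le (by linarith)
  have hLk : L < k + 1 := by rw [hk]; exact Nat.lt_floor_add_one L
  have hk0 : (0 : ℝ) < k := by linarith
  have hk1 : (1 : ℝ) ≤ k := by exact_mod_cast Nat.cast_pos.1 hk0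
  have hL0 : 0 < L := by linarith
  have h1 := sq_half_sub_le_sub_log hb0.le hb (div_pos hL0 hj0) hjb
  have h2 := sub_log_floor_le hk0 hkL (by linarith)
  rw [Real.log_div hL0.ne' hj0.ne'] at h1
  rw [Real.log_div hL0.ne' hk0.ne'] at h2
  have hm0 : 0 ≤ min 1 δ := by positivity
  have h3 : ((L - k) / L) ^ 2 ≤ (min 1 δ / 8 * b) ^ 2 :=
    pow_le_pow_left₀ (div_nonneg (by linarith) hL0.le) hkb 2
  have hmm : min 1 δ * min 1 δ ≤ 1 * δ :=
    mul_le_mul (min_le_left _ _) (min_le_right _ _) hm0 zero_le_one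
  have hb2 : 0 < b ^ 2 := by positivity
  have h4 : (min 1 δ / 8 * b) ^ 2 ≤ δ / 64 * b ^ 2 := by
    have : (min 1 δ / 8 * b) ^ 2 = min 1 δ * min 1 δ / 64 * b ^ 2 := by ring
    rw [this]
    gcongr
    linarith
  have h5 : 2 * b ^ 3 ≤ δ / 8 * b ^ 2 := by
    have : 2 * b ^ 3 = 2 * b * b ^ 2 := by ring
    rw [this]
    gcongr
    linarith
  have hℓ : 0 ≤ Real.log (1 / s) := Real.log_nonneg (by rw [le_div_iff₀ hs]; linarith)
  rw [le_sub_iff_add_le, le_div_iff₀ hs]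
  have h6 : (δ / 2 * Real.log (1 / s) + Real.log (1 / s)) * s ≤
      (1 + δ / 2) * ((1 / 2 - δ / 2) * b ^ 2) := by
    calc _ = (1 + δ / 2) * (s * Real.log (1 / s)) := by ring
      _ ≤ _ := by gcongr
  have h7 : (1 + δ / 2) * ((1 / 2 - δ / 2) * b ^ 2) ≤ (1 / 2 - δ / 4) * b ^ 2 := by
    nlinarith [mul_pos (mul_pos hδ hδ) hb2]
  -- Budget in units of `b ^ 2`: the Taylor remainder costs `δ / 8` and rounding `4 * δ / 64`,
  -- together less than the `δ / 4` left by `h7`.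
  nlinarith [mul_pos hδ hb2]

/-- The number of edges deviates from `L` by the factor `1 / (1 + b)` or `1 / (1 - b)`. -/
def IsAtypical (b L : ℝ) : Set ℕ :=
  {j | ¬ (1 / (1 + b) * L < j ∧ (b < 1 → j < 1 / (1 - b) * L))}

/-- The smaller `b'` allows a large deviation to be replaced by one in the range of the Taylor
estimate. -/
lemma IsAtypical.ratio {b b' L : ℝ} {j : ℕ} (hj : j ∈ IsAtypical b L) (hj1 : 1 ≤ j)
    (hb : 0 < b) (hbb : b' ≤ b) : 1 + b' ≤ L / j ∨ L / j ≤ 1 - b' := by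
  have hj0 : (0 : ℝ) < j := by exact_mod_cast hj1
  have hj' : ¬ (1 / (1 + b) * L < j ∧ (b < 1 → (j : ℝ) < 1 / (1 - b) * L)) := hj
  rw [not_and_or] at hj'
  rcases hj' with h | h
  · left
    rw [not_lt, one_div_mul_eq_div, le_div_iff₀ (by linarith)] at h
    rw [le_div_iff₀ hj0]
    nlinarith
  · right
    push Not at h
    obtain ⟨h1, h⟩ := h
    rw [one_div_mul_eq_div, div_le_iff₀ (by linarith)] at h
    rw [div_le_iff₀ hj0]
    nlinarith

/-- The distribution function of a power of a positive random variable. -/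
lemma measureReal_le_of_identDistrib_rpow {Ω Ω₀ : Type*} [MeasurableSpace Ω]
    [MeasurableSpace Ω₀] {μ : Measure Ω} {Q : Measure Ω₀} [IsProbabilityMeasure Q] {Y : Ω → ℝ}
    {Z : Ω₀ → ℝ} (hZ : Measurable Z) (hZ0 : ∀ᵐ ω ∂Q, 0 < Z ω) {s : ℝ} (hs : 0 < s)
    (h : IdentDistrib Y (fun ω => Z ω ^ s) μ Q) {y : ℝ} (hy : 0 ≤ y) :
    μ.real {ω | Y ω ≤ y} = cdf (Q.map Z) (y ^ (1 / s)) := by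
  have := Measure.isProbabilityMeasure_map (μ := Q) hZ.aemeasurable
  rw [cdf_eq_real, map_measureReal_apply hZ measurableSet_Iic, measureReal_def, measureReal_def]
  have h1 : μ {ω | Y ω ≤ y} = Q {ω | Z ω ^ s ≤ y} := h.measure_mem_eq measurableSet_Iic
  rw [h1]
  congr 1
  refine measure_congr ?_
  filter_upwards [hZ0] with ω hω
  refine propext ?_
  change Z ω ^ s ≤ y ↔ Z ω ≤ y ^ (1 / s)
  rw [one_div, Real.le_rpow_inv_iff_of_pos hω.le hy hs]

/-- Quantitative form of the concentration of the hopcount for one value of `n`. -/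
theorem measureReal_hopcount_mem_isAtypical_le {Ω₀ : Type*} [MeasurableSpace Ω₀] {Q : Measure Ω₀}
    [IsProbabilityMeasure Q] {Z : Ω₀ → ℝ} (hZ : Measurable Z) (hZ0 : ∀ᵐ ω ∂Q, 0 < Z ω)
    {c C x₀ : ℝ} (hc : 0 < c) (hC : 0 < C)
    (hlow : ∀ x, 0 ≤ x → x ≤ x₀ → c * x ≤ cdf (Q.map Z) x)
    (hupp : ∀ x, 0 ≤ x → cdf (Q.map Z) x ≤ C * x)
    {n : ℕ} {s : ℝ} (hs : 0 < s) (hs1 : s ≤ 1) (hL : 2 ≤ s * Real.log n)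
    (hsL : 6 * (s * (s * Real.log n)) ≤ 1) (hx₀ : 48 * (n : ℝ) ^ (-(1 / 2) : ℝ) / c ≤ x₀)
    {b b' δ : ℝ} (hδ : 0 < δ) (hb0 : 0 < b) (hb : b ≤ 1 / 2) (hbδ : b ≤ δ / 16)
    (hbb : b ≤ b')
    (hkb : (s * Real.log n - ⌊s * Real.log n⌋₊) / (s * Real.log n) ≤ min 1 δ / 8 * b)
    (hsb : s * Real.log (1 / s) ≤ (1 / 2 - δ / 2) * b ^ 2)
    (hr : 2 * (C * Real.exp 1) * (48 / c) * Real.exp (-(δ / 2 * Real.log (1 / s))) ≤ 1 / 2)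
    {Ω : Type*} [MeasurableSpace Ω] {μ : Measure Ω} [IsProbabilityMeasure μ]
    {X : Sym2 (Fin n) → Ω → ℝ}
    (hind : iIndepFun (fun e : (⊤ : SimpleGraph (Fin n)).edgeSet => X e) μ)
    (hlaw : ∀ e ∈ (⊤ : SimpleGraph (Fin n)).edgeSet,
      IdentDistrib (X e) (fun ω => Z ω ^ s) μ Q) :
    μ.real {ω | hopcount n (fun e => X e ω) ∈ IsAtypical b' (s * Real.log n)} ≤
      2 * (2 * (C * Real.exp 1) * (48 / c) * Real.exp (-(δ / 2 * Real.log (1 / s)))) +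
        2 * Real.exp (1 - s * Real.log n) := by
  have hfl : 2 ≤ ⌊s * Real.log n⌋₊ := Nat.le_floor (by exact_mod_cast hL)
  -- `k` counts intermediate layers, so the walk found has `k + 1 = ⌊L⌋` edges.
  obtain ⟨k, hk⟩ : ∃ k, k + 1 = ⌊s * Real.log n⌋₊ := ⟨_, Nat.sub_add_cancel (by omega)⟩
  obtain ⟨a, u, p, ha, hu, hup, hM, hn, hp0, hp, herr⟩ :=
    exists_exploration_parameters hs hL hsL hk
  have hn1 : (1 : ℝ) ≤ n := by exact_mod_cast (by omega : 1 ≤ n)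
  have hz0 : 0 < p / c := by positivity
  have hz : p / c ≤ 48 / c * (n : ℝ) ^ (1 / ((k + 1 : ℕ) : ℝ) - 1) := by
    rw [div_mul_eq_mul_div]
    gcongr
  -- As `k + 1 ≥ 2`, the exponent of `n` is at most `-1 / 2`. With `τ = (p / c) ^ s`, an edge is
  -- open with probability `G (p / c) ≥ c * (p / c) = p`.
  have hzx : p / c ≤ x₀ := by
    refine hz.trans (le_trans ?_ hx₀)
    rw [div_mul_eq_mul_div]
    gcongr
    · have : (2 : ℝ) ≤ ((k + 1 : ℕ) : ℝ) := by rw [hk]; exact_mod_cast hfl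
      have : 1 / ((k + 1 : ℕ) : ℝ) ≤ 1 / 2 := by gcongr
      linarith
  have hτ : ((p / c) ^ s) ^ (1 / s) = p / c := by
    rw [← Real.rpow_mul hz0.le, mul_one_div_cancel hs.ne', Real.rpow_one]
  refine (measureReal_hopcount_mem_le (by omega) hind
    (fun e he => (hlaw e he).aemeasurable_fst) (fun e he => ?_) hC.le (one_div_pos.2 hs)
    (fun e he y hy => ?_) (τ := (p / c) ^ s) (by positivity) (p := p) (fun e he => ?_) ha hu hup hM
    le_rfl hn (by positivity) hr (fun j hjJ hj1 => ?_)).trans (add_le_add le_rfl herr)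
  · refine (hlaw e he).symm.ae_snd measurableSet_Ici ?_
    filter_upwards [hZ0] with ω hω
    exact (Real.rpow_pos_of_pos hω s).le
  · rw [measureReal_le_of_identDistrib_rpow hZ hZ0 hs (hlaw e he) hy]
    exact hupp _ (by positivity)
  · rw [measureReal_le_of_identDistrib_rpow hZ hZ0 hs (hlaw e he) (by positivity), hτ]
    refine le_trans (le_of_eq ?_) (hlow _ hz0.le hzx)
    field_simp
  · have hΔ := mul_log_inv_le_exponent hs hs1 hδ hb0 hb hbδ hL hj1 rfl hkb hsb
      (IsAtypical.ratio hjJ hj1 (hb0.trans_le hbb) hbb)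
    rw [← hk] at hΔ
    have h := pow_mul_rpow_pow_le (by omega : 1 ≤ n) hj1 (by omega : 1 ≤ k + 1) hs hs1
      (by positivity : 0 ≤ C * Real.exp 1) hz0 hz hΔ
    push_cast at h
    exact h

end Main

end FirstPassage

theorem theorem5p5
    -- the positive random variable `Z` and its distribution function `G`
    {Ω₀ : Type*} [MeasurableSpace Ω₀] (Q : Measure Ω₀) [IsProbabilityMeasure Q]
    (Z : Ω₀ → ℝ) (hZ_meas : Measurable Z) (hZ_pos : ∀ᵐ ω ∂Q, 0 < Z ω)
    (G : ℝ → ℝ) (hG : ∀ x, G x = cdf (Q.map Z) x) (hG_cont : Continuous G)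
    (xhat : ℝ) (hxhat : 0 < xhat)
    (hG_C2 : ContDiffOn ℝ 2 G (Set.Icc 0 xhat))
    (hG_mono : StrictMonoOn G (Set.Icc 0 xhat))
    (hG_deriv : 0 < derivWithin G (Set.Icc 0 xhat) 0)
    -- the exponents
    (s : ℕ → ℝ) (hs_pos : ∀ n, 0 < s n)
    (hs_log : Tendsto (fun n : ℕ => s n * Real.log n) atTop atTop)
    (hs_sq_log : Tendsto (fun n : ℕ => s n ^ 2 * Real.log n) atTop (𝓝 0))
    -- for every `n`, independent edge weights on the complete graph, distributed as `Z ^ s n`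
    {Ω : ℕ → Type*} [∀ n, MeasurableSpace (Ω n)] (P : ∀ n, Measure (Ω n))
    [∀ n, IsProbabilityMeasure (P n)]
    (X : ∀ n, Sym2 (Fin n) → Ω n → ℝ)
    (hX_indep : ∀ n, iIndepFun (fun e : (⊤ : SimpleGraph (Fin n)).edgeSet => X n e) (P n))
    (hX_law : ∀ n, ∀ e ∈ (⊤ : SimpleGraph (Fin n)).edgeSet,
      IdentDistrib (X n e) (fun ω => Z ω ^ s n) (P n) Q)
    -- the sequence `β`
    (β : ℕ → ℝ) (hβ_pos : ∀ n, 0 < β n)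
    (δ : ℝ) (hδ : 0 < δ)
    (hβ_limsup : limsup (fun n : ℕ => ((s n * Real.log (1 / s n) / β n ^ 2 : ℝ) : EReal)) atTop
      ≤ ((1 / 2 - δ : ℝ) : EReal))
    (hβ_floor : Tendsto
      (fun n : ℕ => (s n * Real.log n - (⌊s n * Real.log n⌋ : ℝ)) / (β n * (s n * Real.log n)))
      atTop (𝓝 0)) :
    Tendsto
      (fun n : ℕ => P n {ω |
        1 / (1 + β n) * (s n * Real.log n) < (FirstPassage.hopcount n (fun e => X n e ω) : ℝ) ∧
        (β n < 1 →
          (FirstPassage.hopcount n (fun e => X n e ω) : ℝ) < 1 / (1 - β n) * (s n * Real.log n))})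
      atTop (𝓝 1) := by
  have hZmap := Measure.isProbabilityMeasure_map (μ := Q) hZ_meas.aemeasurable
  obtain rfl : G = cdf (Q.map Z) := funext hG
  have hG0 : cdf (Q.map Z) 0 = 0 := by
    rw [cdf_eq_real, map_measureReal_apply hZ_meas measurableSet_Iic, measureReal_def,
      ENNReal.toReal_eq_zero_iff]
    left
    refine measure_mono_null (fun ω hω => ?_) (ae_iff.1 hZ_pos)
    exact not_lt.2 hω
  obtain ⟨c, C, x₀, hc, hC, hx₀, hlow, hupp⟩ := FirstPassage.exists_linear_bounds hxhat
    (hG_C2.differentiableOn (by norm_num) 0 ⟨le_rfl, hxhat.le⟩) hG_deriv hG0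
    (fun x => cdf_le_one _ x)
  -- `s` is the quotient of `s ^ 2 * log n → 0` by `s * log n → ∞`.
  have hs0 : Tendsto s atTop (𝓝 0) := by
    refine (hs_sq_log.div_atTop hs_log).congr' ?_
    filter_upwards [hs_log.eventually_gt_atTop 0] with n hn
    rw [pow_two, mul_assoc, mul_div_assoc, div_self hn.ne', mul_one]
  have hs0' : Tendsto s atTop (𝓝[>] 0) :=
    tendsto_nhdsWithin_iff.2 ⟨hs0, Eventually.of_forall hs_pos⟩
  have hlog : Tendsto (fun n => Real.log (1 / s n)) atTop atTop := by
    simp only [one_div]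
    exact Real.tendsto_log_atTop.comp (tendsto_inv_nhdsGT_zero.comp hs0')
  have hslog : Tendsto (fun n => s n * Real.log (1 / s n)) atTop (𝓝 0) := by
    have h := (Real.continuous_mul_log.tendsto 0).comp hs0
    have h2 := h.neg
    simp only [zero_mul, neg_zero] at h2
    refine h2.congr fun n => ?_
    simp [Real.log_inv]
  have hlim : ∀ᶠ n in atTop, s n * Real.log (1 / s n) / β n ^ 2 < 1 / 2 - δ / 2 := by
    have h : limsup (fun n : ℕ => ((s n * Real.log (1 / s n) / β n ^ 2 : ℝ) : EReal)) atTop <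
        ((1 / 2 - δ / 2 : ℝ) : EReal) :=
      hβ_limsup.trans_lt (by rw [EReal.coe_lt_coe_iff]; linarith)
    filter_upwards [eventually_lt_of_limsup_lt h] with n hn
    exact_mod_cast hn
  -- A positive quantity is eventually below this number, so the limsup hypothesis itself forces `δ
  -- < 1`.
  have hδ1 : 0 < 1 / 2 - δ / 2 := by
    obtain ⟨n, hn1, hn2⟩ := (hlim.and (hlog.eventually_gt_atTop 0)).exists
    refine lt_of_le_of_lt ?_ hn1
    have := hs_pos n
    positivity
  -- `β n` need not be small; the estimates are run with `min (β n) c₀`.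
  set c₀ : ℝ := min (1 / 2) (δ / 16) with hc₀
  have hc₀0 : 0 < c₀ := lt_min (by norm_num) (by positivity)
  set η : ℝ := min 1 δ / 8 with hη
  have hη0 : 0 < η := by
    have : 0 < min 1 δ := lt_min one_pos hδ
    positivity
  set err : ℕ → ℝ := fun n =>
    2 * (2 * (C * Real.exp 1) * (48 / c) * Real.exp (-(δ / 2 * Real.log (1 / s n)))) +
        2 * Real.exp (1 - s n * Real.log n) with herr
  have hr : Tendsto (fun n => 2 * (C * Real.exp 1) * (48 / c) *
      Real.exp (-(δ / 2 * Real.log (1 / s n)))) atTop (𝓝 0) := by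
    rw [← mul_zero (2 * (C * Real.exp 1) * (48 / c))]
    refine Tendsto.const_mul _ (Real.tendsto_exp_neg_atTop_nhds_zero.comp ?_)
    exact hlog.const_mul_atTop (by positivity)
  have herr0 : Tendsto err atTop (𝓝 0) := by
    have h2 : Tendsto (fun n : ℕ => Real.exp (1 - s n * Real.log n)) atTop (𝓝 0) :=
      Real.tendsto_exp_atBot.comp (tendsto_atBot_add_const_left _ 1
        (tendsto_neg_atTop_atBot.comp hs_log))
    have h3 := (hr.const_mul 2).add (h2.const_mul 2)
    rwa [mul_zero, add_zero] at h3
  have hx : Tendsto (fun n : ℕ => 48 * (n : ℝ) ^ (-(1 / 2) : ℝ) / c) atTop (𝓝 0) := by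
    have h := ((tendsto_rpow_neg_atTop (y := 1 / 2) (by norm_num)).comp
      (tendsto_natCast_atTop_atTop (R := ℝ))).const_mul 48 |>.div_const c
    rw [mul_zero, zero_div] at h
    exact h
  have hbad : ∀ᶠ n in atTop, (P n).real {ω | FirstPassage.hopcount n (fun e => X n e ω) ∈
      FirstPassage.IsAtypical (β n) (s n * Real.log n)} ≤ err n := by
    filter_upwards [hs0.eventually_le_const one_pos, hs_log.eventually_ge_atTop 2,
      hs_sq_log.eventually_le_const (show (0 : ℝ) < 1 / 6 by norm_num),
      hx.eventually_le_const hx₀, hlim, hr.eventually_le_const (show (0 : ℝ) < 1 / 2 by norm_num),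
      hslog.eventually_le_const (show 0 < (1 / 2 - δ / 2) * c₀ ^ 2 by positivity),
      hβ_floor.eventually_le_const hη0,
      hs_log.eventually_ge_atTop (1 / (η * c₀))] with n h1 h2 h3 h4 h5 h6 h7 h8 h9
    have hL0 : 0 < s n * Real.log n := by linarith
    have hβ := hβ_pos n
    have hfl : ((⌊s n * Real.log n⌋ : ℤ) : ℝ) = (⌊s n * Real.log n⌋₊ : ℝ) :=
      (natCast_floor_eq_intCast_floor hL0.le).symm
    refine FirstPassage.measureReal_hopcount_mem_isAtypical_le hZ_meas hZ_pos hc hC hlow hupp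
      (hs_pos n) h1 h2 (by linarith) h4 hδ (b := min (β n) c₀) (lt_min hβ hc₀0)
      ((min_le_right _ _).trans (min_le_left _ _)) ((min_le_right _ _).trans (min_le_right _ _))
      (min_le_left _ _) ?_ ?_ h6 (hX_indep n) (hX_law n)
    -- If the minimum is `β n`, the floor hypothesis applies; if it is `c₀`, the fractional part is
    -- below `1 ≤ η * c₀ * L`.
    · rw [← hη]
      rcases min_choice (β n) c₀ with h | h <;> rw [h]
      · rw [hfl, div_le_iff₀ (by positivity)] at h8
        rw [div_le_iff₀ hL0]
        linarith
      · rw [div_le_iff₀ hL0]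
        rw [div_le_iff₀ (by positivity)] at h9
        linarith [Nat.lt_floor_add_one (s n * Real.log n)]
    · rcases min_choice (β n) c₀ with h | h <;> rw [h]
      · rw [div_lt_iff₀ (by positivity)] at h5
        exact h5.le
      · exact h7
  have hlower : Tendsto (fun n => ENNReal.ofReal (1 - err n)) atTop (𝓝 1) := by
    simpa using ENNReal.tendsto_ofReal (herr0.const_sub 1)
  refine tendsto_of_tendsto_of_tendsto_of_le_of_le' hlower tendsto_const_nhds ?_
    (Eventually.of_forall fun n => prob_le_one)
  filter_upwards [hbad] with n hn
  set E : Set (Ω n) := {ω |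
        1 / (1 + β n) * (s n * Real.log n) < (FirstPassage.hopcount n (fun e => X n e ω) : ℝ) ∧
        (β n < 1 →
          (FirstPassage.hopcount n (fun e => X n e ω) : ℝ) < 1 / (1 - β n) * (s n * Real.log n))}
  have hn' : (P n).real Eᶜ ≤ err n := hn
  -- Subadditivity is enough, so measurability of the event is not needed.
  have hE : 1 ≤ (P n).real E + (P n).real Eᶜ := by
    rw [← probReal_univ (μ := P n), ← Set.union_compl_self E]
    exact measureReal_union_le _ _
  refine ENNReal.ofReal_le_of_le_toReal ?_
  change 1 - err n ≤ (P n).real E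
  linarith
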